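/- **Generalized Laplace Analysis.** Let $F$ be a complex Hausdorff locally convex space that is separable and locally sequentially weakly compact (every bounded sequence has a weakly convergent subsequence), and let $L(F)$ be the space of continuous linear operators on $F$. Let $(S,\Sigma)$ be a measurable space and $m:\Sigma\to L(F)$ an equicontinuous spectral measure: $m$ is countably additive in the weak operator topology, $m(S)=I$, $m(A\cap B)=m(A)m(B)$, and $\{m(A):A\in\Sigma\}$ is equicontinuous. Let $f:S\to\mathbb C$ be bounded and measurable, let $U=\int_S f\,dm\in L(F)$ (the pointwise limit of the integrals of simple functions converging uniformly to $f$), and put $E(B)=m(f^{-1}(B))$ for Borel sets $B\subseteq\mathbb C$. Let $\sigma(U)$ be the complement of the set of $\xi\in\mathbb C$ for which $\xi I-U$ is injective with dense image and has a continuous inverse on its image, and let $\sigma_p(U)$ be the set of $\xi\in\sigma(U)$ for which $\xi I-U$ is not injective. With $D_r=\{|z|<r\}$, assume that $U$ has dominating point spectrum with radius $R>0$, that is: $\sigma(U)\setminus D_R\neq\emptyset$, and for every $r>R$, 1. if $\sigma(U)\cap D_r$ contains an eigenvalue, then some $\xi\in\sigma(U)\cap D_r$ satisfies $|\xi|=\sup\{|z|:z\in\sigma(U)\cap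 D_r\}$; 2. $\sigma(U)\setminus D_r\subseteq\sigma_p(U)$. Assume also that the point spectrum is concentrated on isolated circles: every point of $\{|f(s)|: s\in S,\ f(s)I-U\text{ is not injective}\}$ is an isolated point of this set. Let $\lambda\in\sigma_p(U)$ with $|\lambda|\ge R$, let $\Omega=\{\mu\in\sigma_p(U):|\mu|>|\lambda|\}$, and write $P_\mu=E(\{\mu\})$. For $T\in L(F)$ let $A_n(T)=n^{-1}\sum_{k=0}^{n-1}T^k$. Then: * The image of $P_\lambda$ is the eigenspace $N(\lambda I-U)$. * The sum $\sum_{\mu\in\Omega}P_\mu$ converges unconditionally in the strong operator topology to an operator in $L(F)$, and, in the strong operator topology, $$P_\lambda=\lim_{n\to\infty}A_n\Big(\lambda^{-1}U\big(I-\sum_{\mu\in\Omega}P_\mu\big)\Big)=\lim_{n\to\infty}\frac1n\sum_{k=1}^{n-1}\lambda^{-k}U^k\Big(I-\sum_{\mu\in\Omega}P_\mu\Big).$$ * If $\Omega$ is finite, then for every $\psi\in F$ the vector $P_\lambda\psi$ is obtained by a finite recursion: for every enumeration $\Omega=\{\nu_1,\dots,\nu_N\}$ without repetition with $|\nu_1|\ge\dots\ge|\nu_N|$,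 put $\rho_0=\psi$ and, successively for $j=1,\dots,N$, $\varphi_j=\lim_{n}A_n(\nu_j^{-1}U)\rho_{j-1}$ and $\rho_j=\rho_{j-1}-\varphi_j$. All these limits exist, $\varphi_j=P_{\nu_j}\psi$, and $\lim_{n}A_n(\lambda^{-1}U)\rho_N=P_\lambda\psi$. -/

import Mathlib

open Filter Topology

/-- A topological vector space is locally sequentially weakly compact if every bounded sequence
has a subsequence which converges weakly to an element of the space. -/
def LocallySeqWeaklyCompact (F : Type*) [AddCommGroup F] [Module ℂ F] [TopologicalSpace F] :
    Prop :=
  ∀ u : ℕ → F, Bornology.IsVonNBounded ℂ (Set.range u) →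
    ∃ (x : F) (φ : ℕ → ℕ), StrictMono φ ∧
      ∀ y : F →L[ℂ] ℂ, Tendsto (fun n => y (u (φ n))) atTop (𝓝 (y x))

section Operators

variable {F : Type*} [AddCommGroup F] [Module ℂ F] [TopologicalSpace F]
  [IsTopologicalAddGroup F] [ContinuousSMul ℂ F]

/-- A spectral measure on the measurable space `S` with values in the continuous operators on `F`:
it is countably additive in the weak operator topology, sends `S` to the identity and intersections
to products. Only its values on measurable sets are meaningful. -/
structure OperatorSpectralMeasure (S : Type*) [MeasurableSpace S] (F : Type*) [AddCommGroup F]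
    [Module ℂ F] [TopologicalSpace F] [IsTopologicalAddGroup F] [ContinuousSMul ℂ F] where
  toFun : Set S → F →L[ℂ] F
  univ_eq_one : toFun Set.univ = 1
  inter_eq_mul : ∀ A B : Set S, MeasurableSet A → MeasurableSet B →
    toFun (A ∩ B) = toFun A * toFun B
  hasSum_iUnion : ∀ A : ℕ → Set S, (∀ i, MeasurableSet (A i)) →
    Pairwise (fun i j => Disjoint (A i) (A j)) → ∀ (x : F) (y : F →L[ℂ] ℂ),
      HasSum (fun i => y (toFun (A i) x)) (y (toFun (⋃ i, A i) x))

/-- The values of the spectral measure on measurable sets form an equicontinuous family. -/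
def OperatorSpectralMeasure.IsEquicontinuous {S : Type*} [MeasurableSpace S]
    (m : OperatorSpectralMeasure S F) : Prop :=
  ∀ p : Seminorm ℂ F, Continuous p → ∃ q : Seminorm ℂ F, Continuous q ∧
    ∀ A : Set S, MeasurableSet A → ∀ x : F, p (m.toFun A x) ≤ q x

/-- The integral of a simple function against a spectral measure. -/
noncomputable def OperatorSpectralMeasure.simpleIntegral {S : Type*} [MeasurableSpace S]
    (m : OperatorSpectralMeasure S F) (g : MeasureTheory.SimpleFunc S ℂ) : F →L[ℂ] F :=
  ∑ c ∈ g.range, c • m.toFun (g ⁻¹' {c})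

/-- `U = ∫ f dm`: the operator `U` is the pointwise limit of the integrals of a sequence of simple
functions that converges uniformly to `f`. -/
def OperatorSpectralMeasure.HasIntegral {S : Type*} [MeasurableSpace S]
    (m : OperatorSpectralMeasure S F) (f : S → ℂ) (U : F →L[ℂ] F) : Prop :=
  ∃ g : ℕ → MeasureTheory.SimpleFunc S ℂ,
    TendstoUniformly (fun n s => g n s) f atTop ∧
      ∀ x : F, Tendsto (fun n => m.simpleIntegral (g n) x) atTop (𝓝 (U x))

/-- The spectral measure on `ℂ` obtained from `m` by the change of variables `f`, that is
`E(B) = m(f⁻¹(B))`. -/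
def OperatorSpectralMeasure.resolution {S : Type*} [MeasurableSpace S]
    (m : OperatorSpectralMeasure S F) (f : S → ℂ) (B : Set ℂ) : F →L[ℂ] F :=
  m.toFun (f ⁻¹' B)

/-- The resolvent set: those `ξ` for which the image of `ξ I - U` is dense and `ξ I - U` has a
continuous inverse defined on its image (so `ξ I - U` is a topological embedding). -/
def opResolventSet (U : F →L[ℂ] F) : Set ℂ :=
  {ξ | DenseRange (ξ • (1 : F →L[ℂ] F) - U) ∧ IsEmbedding (ξ • (1 : F →L[ℂ] F) - U)}

/-- The spectrum `σ(U)`. -/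
def opSpectrum (U : F →L[ℂ] F) : Set ℂ := (opResolventSet U)ᶜ

/-- The point spectrum `σ_p(U)`. -/
def opPointSpectrum (U : F →L[ℂ] F) : Set ℂ :=
  {ξ ∈ opSpectrum U | ¬ Function.Injective (ξ • (1 : F →L[ℂ] F) - U)}

/-- The elements of `A` whose modulus is the supremum of the moduli of the elements of `A`. -/
def peripheralPart (A : Set ℂ) : Set ℂ := {ξ ∈ A | IsLUB ((fun z : ℂ => ‖z‖) '' A) ‖ξ‖}

/-- `R` witnesses that `U` has dominating point spectrum. -/
structure IsDominatingRadius (U : F →L[ℂ] F) (R : ℝ) : Prop where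
  pos : 0 < R
  nonempty : (opSpectrum U \ Metric.ball 0 R).Nonempty
  peripheral : ∀ r : ℝ, R < r →
    ((opSpectrum U ∩ Metric.ball 0 r) ∩ opPointSpectrum U).Nonempty →
      (peripheralPart (opSpectrum U ∩ Metric.ball 0 r)).Nonempty
  eigenvalues : ∀ r : ℝ, R < r → opSpectrum U \ Metric.ball 0 r ⊆ opPointSpectrum U

/-- The moduli of those values of `f` that are eigenvalues of `U`. -/
def pointSpectrumRadii {S : Type*} (f : S → ℂ) (U : F →L[ℂ] F) : Set ℝ :=
  {r | ∃ s : S, ‖f s‖ = r ∧ ¬ Function.Injective (f s • (1 : F →L[ℂ] F) - U)}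

/-- The point spectrum of `U = ∫ f dm` is concentrated on isolated circles. -/
def PointSpectrumOnIsolatedCircles {S : Type*} (f : S → ℂ) (U : F →L[ℂ] F) : Prop :=
  ∀ r ∈ pointSpectrumRadii f U, ∃ ε > 0, ∀ r' ∈ pointSpectrumRadii f U, |r' - r| < ε → r' = r

/-- The averages `A_n(T) = n⁻¹ ∑_{k=0}^{n-1} T^k`. -/
noncomputable def opAverage (n : ℕ) (T : F →L[ℂ] F) : F →L[ℂ] F :=
  (n : ℂ)⁻¹ • ∑ k ∈ Finset.range n, T ^ k

/-- The eigenvalues of `U` of modulus larger than that of `lam`. -/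
def largerEigenvalues (U : F →L[ℂ] F) (lam : ℂ) : Set ℂ :=
  {ν ∈ opPointSpectrum U | ‖lam‖ < ‖ν‖}

end Operators

/-! Integration against `m` is multiplicative, and equicontinuity bounds `p (U x)` by `4 * sup |f| *
q x`, so identities and estimates between operators reduce to those between functions. Inverting `ξ
- f` approximately where `|ξ - f| ≥ δ` shows that `E({ξ})` has the eigenspace of `ξ` as its image,
and that the complementary projection maps into the closure of the range of `ξ - U`. For `ξ = 1` and
an integrand of modulus at most one this is the mean ergodic theorem (`tendsto_opAverage`). Once
`E({|z| > |λ|})` is removed, `λ⁻¹ U` has such an integrand, equal to `1` exactly where `f = λ`.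

It remains to identify `E({|z| > |λ|})` with the sum of the `P_μ`. The spectrum in this region
consists of eigenvalues, but uncountably many of them might carry a diffuse measure. By Hahn-Banach
it suffices to exclude this for scalar measures (`dual_resolution_eq_zero`), by two facts. Around a
resolvent point the measure of a disc is `O(r³)`, whereas a finite planar measure is at least of
order `r²` around almost each of its points; so the measure lives on the spectrum. And an atomless
`ν` gives measure zero to the `z` with `E({z}) ≠ 0`: there is a `G` such that the characters
`exp(-2πikG)` diverge `ν`-almost everywhere along each given subsequence, while a weakly convergent
subsequence of their integrals applied to `x`, seen through `E({z})`, converges at every `z` with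
`E({z}) x ≠ 0`. Separability leaves only countably many `x`. -/

set_option linter.unusedSectionVars false

/-! ### Functionals and seminorms on locally convex spaces -/

section LocallyConvex

variable {F : Type*} [AddCommGroup F] [Module ℂ F] [TopologicalSpace F]
  [IsTopologicalAddGroup F] [ContinuousSMul ℂ F] [PolynormableSpace ℂ F]

theorem PolynormableSpace.locallyConvexSpace_real : LocallyConvexSpace ℝ F :=
  (PolynormableSpace.withSeminorms ℂ F).toLocallyConvexSpace

/-- A vector annihilated by every continuous functional vanishing on a subspace lies in the
closure of this subspace. -/
theorem mem_closure_of_forall_dual (N : Submodule ℂ F) (x : F)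
    (h : ∀ y : F →L[ℂ] ℂ, (∀ v ∈ N, y v = 0) → y x = 0) : x ∈ closure (N : Set F) := by
  have := PolynormableSpace.locallyConvexSpace_real (F := F)
  by_contra hx
  obtain ⟨y, u, hy, hu⟩ := RCLike.geometric_hahn_banach_closed_point (𝕜 := ℂ)
    (s := (N.topologicalClosure : Set F)) ((N.topologicalClosure.restrictScalars ℝ).convex)
    N.isClosed_topologicalClosure hx
  have h0 : ∀ v ∈ N, y v = 0 := by
    intro v hv
    by_contra hne
    -- The multiple of `v` on which `y` takes the value `u` violates the strict bound by `u`.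
    have h1 := hy _ (N.le_topologicalClosure (N.smul_mem ((u : ℂ) / y v) hv))
    simp [hne] at h1
  have h1 := hy 0 (N.topologicalClosure.zero_mem)
  rw [h y h0] at hu
  simp at h1 hu
  linarith

theorem eq_zero_of_forall_dual [T2Space F] (x : F) (h : ∀ y : F →L[ℂ] ℂ, y x = 0) : x = 0 := by
  have := mem_closure_of_forall_dual (⊥ : Submodule ℂ F) x (fun y _ => h y)
  simpa using this

theorem eq_of_forall_dual [T2Space F] {x x' : F} (h : ∀ y : F →L[ℂ] ℂ, y x = y x') : x = x' :=
  sub_eq_zero.1 (eq_zero_of_forall_dual _ fun y => by simp [h y])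

theorem tendsto_iff_seminorm {ι : Type*} {l : Filter ι} {u : ι → F} {x : F} :
    Tendsto u l (𝓝 x) ↔ ∀ p : Seminorm ℂ F, Continuous p → Tendsto (fun i => p (u i - x)) l (𝓝 0) := by
  constructor
  · intro h p hp
    have := (hp.tendsto (x - x)).comp (h.sub_const x)
    simpa [Function.comp_def] using this
  · intro h
    rw [(PolynormableSpace.withSeminorms ℂ F).tendsto_nhds]
    rintro ⟨p, hp⟩ ε hε
    exact (h p hp).eventually (gt_mem_nhds hε)

theorem eq_zero_of_forall_seminorm [T2Space F] (x : F)
    (h : ∀ p : Seminorm ℂ F, Continuous p → p x = 0) : x = 0 := by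
  by_contra hx
  obtain ⟨⟨p, hp⟩, hne⟩ := (PolynormableSpace.withSeminorms ℂ F).separating_of_T1 x hx
  exact hne (h p hp)

theorem exists_seminorm_sub_lt_of_mem_closure {N : Set F} {x : F} (hx : x ∈ closure N)
    {p : Seminorm ℂ F} (hp : Continuous p) {ε : ℝ} (hε : 0 < ε) : ∃ v ∈ N, p (x - v) < ε := by
  have ho : IsOpen {v | p (x - v) < ε} :=
    isOpen_lt (hp.comp (continuous_const.sub continuous_id)) continuous_const
  obtain ⟨v, hv, hvN⟩ := mem_closure_iff.1 hx _ ho (by simpa using hε)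
  exact ⟨v, hvN, hv⟩

end LocallyConvex

/-! ### Seminorm bounds for sums with bounded coefficients -/

/-- A seminorm that is bounded on all partial sums is bounded on all combinations with
coefficients in the unit interval. -/
theorem Seminorm.sum_smul_le_of_forall_subset {F ι : Type*} [AddCommGroup F] [Module ℂ F]
    (p : Seminorm ℂ F) (s : Finset ι) (v : ι → F) (c : ι → ℝ) (hc : ∀ i ∈ s, 0 ≤ c i ∧ c i ≤ 1)
    (M : ℝ) (w : F) (h : ∀ t ⊆ s, p (w + ∑ i ∈ t, v i) ≤ M) :
    p (w + ∑ i ∈ s, (c i : ℂ) • v i) ≤ M := by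
  classical
  induction s using Finset.induction_on generalizing w with
  | empty => simpa using h ∅ (by simp)
  | insert a s ha ih =>
    have hc' : ∀ i ∈ s, 0 ≤ c i ∧ c i ≤ 1 := fun i hi => hc i (Finset.mem_insert_of_mem hi)
    -- The shift `w` records whether `a` is chosen; the sum is a convex combination of the two
    -- cases.
    have h0 := ih hc' w (fun t ht => h t (ht.trans (Finset.subset_insert _ _)))
    have h1 := ih hc' (w + v a) (fun t ht => by
      have := h (insert a t) (Finset.insert_subset_insert a ht)
      rwa [Finset.sum_insert (fun hat => ha (ht hat)), ← add_assoc] at this)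
    obtain ⟨ca0, ca1⟩ := hc a (Finset.mem_insert_self a s)
    rw [Finset.sum_insert ha]
    set z := ∑ i ∈ s, (c i : ℂ) • v i
    have e : w + ((c a : ℂ) • v a + z) =
        ((1 - c a : ℝ) : ℂ) • (w + z) + ((c a : ℝ) : ℂ) • (w + v a + z) := by
      push_cast
      module
    rw [e]
    calc _ ≤ _ := map_add_le_add p _ _
      _ = (1 - c a) * p (w + z) + c a * p (w + v a + z) := by
        rw [map_smul_eq_mul, map_smul_eq_mul, Complex.norm_real, Complex.norm_real,
          Real.norm_of_nonneg ca0, Real.norm_of_nonneg (by linarith)]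
      _ ≤ (1 - c a) * M + c a * M := by gcongr
      _ = M := by ring

/-- Positive and negative parts of the real and imaginary parts of `c i / K` lie in the unit
interval; these four sums give the factor 4. -/
theorem Seminorm.sum_smul_le_four_mul {F ι : Type*} [AddCommGroup F] [Module ℂ F]
    (p : Seminorm ℂ F) (s : Finset ι) (v : ι → F) (c : ι → ℂ) (K : ℝ) (hK : 0 < K)
    (hc : ∀ i ∈ s, ‖c i‖ ≤ K) (M : ℝ) (h : ∀ t ⊆ s, p (∑ i ∈ t, v i) ≤ M) :
    p (∑ i ∈ s, c i • v i) ≤ 4 * K * M := by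
  have key : ∀ d : ι → ℝ, (∀ i ∈ s, d i ≤ K) →
      p (∑ i ∈ s, ((max (d i) 0 / K : ℝ) : ℂ) • v i) ≤ M := fun d hd => by
    have := p.sum_smul_le_of_forall_subset s v (fun i => max (d i) 0 / K)
      (fun i hi => ⟨by positivity, (div_le_one hK).2 (max_le (hd i hi) hK.le)⟩) M 0
      (by simpa using h)
    simpa using this
  have h1 := key (fun i => (c i).re) fun i hi => ((le_abs_self _).trans (Complex.abs_re_le_norm _)).trans (hc i hi)
  have h2 := key (fun i => -(c i).re) fun i hi => ((neg_le_abs _).trans (Complex.abs_re_le_norm _)).trans (hc i hi)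
  have h3 := key (fun i => (c i).im) fun i hi => ((le_abs_self _).trans (Complex.abs_im_le_norm _)).trans (hc i hi)
  have h4 := key (fun i => -(c i).im) fun i hi => ((neg_le_abs _).trans (Complex.abs_im_le_norm _)).trans (hc i hi)
  set s1 := ∑ i ∈ s, ((max (c i).re 0 / K : ℝ) : ℂ) • v i
  set s2 := ∑ i ∈ s, ((max (-(c i).re) 0 / K : ℝ) : ℂ) • v i
  set s3 := ∑ i ∈ s, ((max (c i).im 0 / K : ℝ) : ℂ) • v i
  set s4 := ∑ i ∈ s, ((max (-(c i).im) 0 / K : ℝ) : ℂ) • v i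
  have e : ∑ i ∈ s, c i • v i = (K : ℂ) • (s1 + ((-1 : ℂ) • s2 + (Complex.I • s3 + (-Complex.I) • s4))) := by
    simp only [s1, s2, s3, s4, Finset.smul_sum, ← Finset.sum_add_distrib, smul_smul, ← add_smul]
    refine Finset.sum_congr rfl fun i _ => ?_
    congr 1
    have hK' : (K : ℂ) ≠ 0 := by exact_mod_cast hK.ne'
    have hm : ∀ r : ℝ, max r 0 - max (-r) 0 = r := fun r => by
      rcases le_total r 0 with hr | hr <;> simp [hr]
    conv_lhs => rw [← Complex.re_add_im (c i), ← hm (c i).re, ← hm (c i).im]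
    push_cast
    field_simp
    ring
  rw [e, map_smul_eq_mul, Complex.norm_real, Real.norm_of_nonneg hK.le]
  have n1 := map_add_le_add p s1 ((-1 : ℂ) • s2 + (Complex.I • s3 + (-Complex.I) • s4))
  have n2 := map_add_le_add p ((-1 : ℂ) • s2) (Complex.I • s3 + (-Complex.I) • s4)
  have n3 := map_add_le_add p (Complex.I • s3) ((-Complex.I) • s4)
  simp only [map_smul_eq_mul, norm_neg, Complex.norm_I, norm_one, one_mul] at n1 n2 n3
  nlinarith

/-! ### Integrals of simple functions -/

namespace OperatorSpectralMeasure

open MeasureTheory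

variable {F : Type*} [AddCommGroup F] [Module ℂ F] [TopologicalSpace F]
  [IsTopologicalAddGroup F] [ContinuousSMul ℂ F] [PolynormableSpace ℂ F] [T2Space F]
  {S : Type*} [MeasurableSpace S] (m : OperatorSpectralMeasure S F)

theorem toFun_empty : m.toFun ∅ = 0 := by
  ext x
  refine eq_of_forall_dual fun y => ?_
  -- A constant series converges only if its term is zero.
  have h := m.hasSum_iUnion (fun _ => ∅) (fun _ => MeasurableSet.empty) (fun _ _ _ => by simp) x y
  simpa using (summable_const_iff _).1 h.summable

open Classical in
/-- The complex measure `A ↦ y (m A x)`. -/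
noncomputable def toComplexMeasure (x : F) (y : F →L[ℂ] ℂ) : ComplexMeasure S where
  measureOf' A := if MeasurableSet A then y (m.toFun A x) else 0
  empty' := by simp [toFun_empty]
  not_measurable' A hA := by simp [hA]
  m_iUnion' A hA hd := by
    simpa [hA, MeasurableSet.iUnion hA] using m.hasSum_iUnion A hA hd x y

theorem toComplexMeasure_apply (x : F) (y : F →L[ℂ] ℂ) {A : Set S} (hA : MeasurableSet A) :
    m.toComplexMeasure x y A = y (m.toFun A x) := if_pos hA

theorem toFun_union {A B : Set S} (hA : MeasurableSet A) (hB : MeasurableSet B)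
    (h : Disjoint A B) : m.toFun (A ∪ B) = m.toFun A + m.toFun B := by
  ext x
  refine eq_of_forall_dual fun y => ?_
  have := (m.toComplexMeasure x y).of_union h hA hB
  simpa [toComplexMeasure_apply, hA, hB, hA.union hB] using this

theorem toFun_compl {A : Set S} (hA : MeasurableSet A) : m.toFun Aᶜ = 1 - m.toFun A := by
  have := m.toFun_union hA hA.compl disjoint_compl_right
  rw [Set.union_compl_self, m.univ_eq_one] at this
  rw [this]; abel

theorem toFun_biUnion_finset {ι : Type*} (t : Finset ι) (A : ι → Set S)
    (hA : ∀ i ∈ t, MeasurableSet (A i)) (hd : (t : Set ι).PairwiseDisjoint A) :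
    m.toFun (⋃ i ∈ t, A i) = ∑ i ∈ t, m.toFun (A i) := by
  classical
  induction t using Finset.induction_on with
  | empty => simp [toFun_empty]
  | insert a t ha ih =>
    have hA' := fun i hi => hA i (Finset.mem_insert_of_mem hi)
    rw [Finset.set_biUnion_insert, toFun_union m (hA a (by simp)) (t.measurableSet_biUnion hA'),
      Finset.sum_insert ha, ih hA' (hd.subset (by simp))]
    rw [Set.disjoint_iUnion₂_right]
    exact fun i hi => hd (by simp) (by simp [hi]) (fun h => ha (h ▸ hi))

theorem toFun_mul_of_disjoint {A B : Set S} (hA : MeasurableSet A) (hB : MeasurableSet B)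
    (h : Disjoint A B) : m.toFun A * m.toFun B = 0 := by
  rw [← m.inter_eq_mul A B hA hB, h.inter_eq, toFun_empty]

/-- The integral can be computed on any finer partition. Applied to `g.pair h`, this gives two
simple functions a common partition, whence additivity and multiplicativity. -/
theorem simpleIntegral_map {β : Type*} (g : SimpleFunc S β) (φ : β → ℂ) :
    m.simpleIntegral (g.map φ) = ∑ b ∈ g.range, φ b • m.toFun (g ⁻¹' {b}) := by
  classical
  rw [simpleIntegral, SimpleFunc.range_map,
    ← Finset.sum_fiberwise_of_maps_to (s := g.range) (t := g.range.image φ) (g := φ)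
      (fun b hb => Finset.mem_image_of_mem φ hb)]
  refine Finset.sum_congr rfl fun c _ => ?_
  have : (g.map φ) ⁻¹' {c} = ⋃ b ∈ g.range.filter (fun b => φ b = c), g ⁻¹' {b} := by
    ext s; simp
  rw [this, toFun_biUnion_finset _ _ _ (fun b _ => g.measurableSet_preimage _), Finset.smul_sum]
  · refine Finset.sum_congr rfl fun b hb => ?_
    rw [(Finset.mem_filter.1 hb).2]
  · intro b _ b' _ hbb
    exact Disjoint.preimage _ (by simpa using hbb)

theorem simpleIntegral_add (g h : SimpleFunc S ℂ) :
    m.simpleIntegral (g + h) = m.simpleIntegral g + m.simpleIntegral h := by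
  have e1 : g + h = (g.pair h).map (fun b => b.1 + b.2) := rfl
  have e2 : m.simpleIntegral g = m.simpleIntegral ((g.pair h).map Prod.fst) := rfl
  have e3 : m.simpleIntegral h = m.simpleIntegral ((g.pair h).map Prod.snd) := rfl
  rw [e1, e2, e3]
  simp only [simpleIntegral_map, ← Finset.sum_add_distrib, add_smul]

theorem simpleIntegral_smul (c : ℂ) (g : SimpleFunc S ℂ) :
    m.simpleIntegral (c • g) = c • m.simpleIntegral g := by
  have e1 : c • g = g.map (fun b => c • b) := rfl
  rw [e1, simpleIntegral_map, simpleIntegral, Finset.smul_sum]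
  simp only [smul_smul, smul_eq_mul]

theorem simpleIntegral_mul (g h : SimpleFunc S ℂ) :
    m.simpleIntegral (g * h) = m.simpleIntegral g * m.simpleIntegral h := by
  classical
  have e1 : g * h = (g.pair h).map (fun b => b.1 * b.2) := rfl
  have e2 : m.simpleIntegral g = m.simpleIntegral ((g.pair h).map Prod.fst) := rfl
  have e3 : m.simpleIntegral h = m.simpleIntegral ((g.pair h).map Prod.snd) := rfl
  rw [e1, e2, e3]
  simp only [simpleIntegral_map, Finset.sum_mul_sum]
  refine Finset.sum_congr rfl fun b hb => ?_
  rw [Finset.sum_eq_single_of_mem b hb]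
  · rw [smul_mul_smul_comm, ← m.inter_eq_mul _ _ ((g.pair h).measurableSet_preimage _)
      ((g.pair h).measurableSet_preimage _), Set.inter_self]
  · intro b' _ hne
    rw [smul_mul_smul_comm, m.toFun_mul_of_disjoint ((g.pair h).measurableSet_preimage _)
      ((g.pair h).measurableSet_preimage _) (Disjoint.preimage _ (by simpa using hne.symm)),
      smul_zero]

theorem simpleIntegral_const (c : ℂ) :
    m.simpleIntegral (SimpleFunc.const S c) = c • (1 : F →L[ℂ] F) := by
  have e : SimpleFunc.const S c = (SimpleFunc.const S ()).map (fun _ => c) := rfl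
  rw [e, simpleIntegral_map]
  rcases isEmpty_or_nonempty S with hS | hS
  -- If `S` is empty, then `1 = m ∅ = 0` and `F` is trivial.
  · rw [← m.univ_eq_one, Set.eq_empty_of_isEmpty Set.univ, toFun_empty, smul_zero]
    refine Finset.sum_eq_zero fun b _ => ?_
    rw [Set.eq_empty_of_isEmpty (_ ⁻¹' _), toFun_empty, smul_zero]
  · rw [SimpleFunc.range_const, Finset.sum_singleton, ← m.univ_eq_one]
    congr 2
    ext; simp

open Classical in
/-- The simple function `1_A`. -/
noncomputable def indicatorSimple {A : Set S} (hA : MeasurableSet A) : SimpleFunc S ℂ :=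
  SimpleFunc.piecewise A hA (SimpleFunc.const S 1) (SimpleFunc.const S 0)

theorem coe_indicatorSimple {A : Set S} (hA : MeasurableSet A) :
    ⇑(indicatorSimple hA) = A.indicator (fun _ => (1 : ℂ)) := by
  ext s
  simp only [indicatorSimple, SimpleFunc.coe_piecewise, SimpleFunc.coe_const]
  rfl

theorem simpleIntegral_indicator {A : Set S} (hA : MeasurableSet A) :
    m.simpleIntegral (indicatorSimple hA) = m.toFun A := by
  classical
  have hp : indicatorSimple hA ⁻¹' {1} = A := by
    ext s; simp [coe_indicatorSimple, Set.indicator_apply]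
  have hsub : (indicatorSimple hA).range ⊆ {0, 1} := by
    intro c hc
    obtain ⟨s, rfl⟩ := SimpleFunc.mem_range.1 hc
    by_cases h : s ∈ A <;> simp [coe_indicatorSimple, h]
  rw [simpleIntegral, Finset.sum_subset hsub]
  · rw [Finset.sum_pair zero_ne_one, zero_smul, zero_add, one_smul, hp]
  · intro c _ hc
    rw [show indicatorSimple hA ⁻¹' {c} = ∅ from ?_, toFun_empty, smul_zero]
    ext s
    simp only [Set.mem_preimage, Set.mem_singleton_iff, Set.mem_empty_iff_false, iff_false]
    rintro rfl
    exact hc (SimpleFunc.mem_range_self _ s)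

/-- Sums of the `m (g⁻¹{c})` over sets of values are again values of `m`, hence uniformly bounded by
`q`. -/
theorem seminorm_simpleIntegral_le {p q : Seminorm ℂ F}
    (hpq : ∀ A : Set S, MeasurableSet A → ∀ x : F, p (m.toFun A x) ≤ q x)
    (g : SimpleFunc S ℂ) {K : ℝ} (hK : 0 < K) (hg : ∀ s, ‖g s‖ ≤ K) (x : F) :
    p (m.simpleIntegral g x) ≤ 4 * K * q x := by
  rw [simpleIntegral, sum_apply]
  simp only [smul_apply]
  refine p.sum_smul_le_four_mul _ _ _ K hK (fun c hc => ?_) _ fun t _ => ?_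
  · obtain ⟨s, rfl⟩ := SimpleFunc.mem_range.1 hc
    exact hg s
  · rw [← sum_apply, ← m.toFun_biUnion_finset]
    · exact hpq _ (t.measurableSet_biUnion fun c _ => g.measurableSet_preimage _) x
    · exact fun c _ => g.measurableSet_preimage _
    · intro b _ b' _ hbb
      exact Disjoint.preimage _ (by simpa using hbb)

end OperatorSpectralMeasure

/-! ### Functional calculus for uniform limits of simple functions -/

namespace OperatorSpectralMeasure

open MeasureTheory

variable {F : Type*} [AddCommGroup F] [Module ℂ F] [TopologicalSpace F]
  [IsTopologicalAddGroup F] [ContinuousSMul ℂ F] [PolynormableSpace ℂ F] [T2Space F]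
  {S : Type*} [MeasurableSpace S] {m : OperatorSpectralMeasure S F}

theorem hasIntegral_simpleFunc (m : OperatorSpectralMeasure S F) (g : SimpleFunc S ℂ) :
    m.HasIntegral g (m.simpleIntegral g) :=
  ⟨fun _ => g, fun _ hu => Eventually.of_forall fun _ _ => refl_mem_uniformity hu,
    fun _ => tendsto_const_nhds⟩

theorem hasIntegral_indicator (m : OperatorSpectralMeasure S F) {A : Set S}
    (hA : MeasurableSet A) : m.HasIntegral (A.indicator fun _ => (1 : ℂ)) (m.toFun A) := by
  rw [← m.simpleIntegral_indicator hA, ← coe_indicatorSimple hA]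
  exact m.hasIntegral_simpleFunc _

theorem hasIntegral_const (m : OperatorSpectralMeasure S F) (c : ℂ) :
    m.HasIntegral (fun _ => c) (c • (1 : F →L[ℂ] F)) := by
  rw [← m.simpleIntegral_const c]
  exact m.hasIntegral_simpleFunc (SimpleFunc.const S c)

theorem HasIntegral.congr {f g : S → ℂ} {U : F →L[ℂ] F} (h : m.HasIntegral f U)
    (hfg : ∀ s, g s = f s) : m.HasIntegral g U := (funext hfg : g = f) ▸ h

theorem HasIntegral.add {f g : S → ℂ} {U V : F →L[ℂ] F} (hf : m.HasIntegral f U)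
    (hg : m.HasIntegral g V) : m.HasIntegral (fun s => f s + g s) (U + V) := by
  obtain ⟨u, hu, hu'⟩ := hf
  obtain ⟨v, hv, hv'⟩ := hg
  refine ⟨fun n => u n + v n, hu.add hv, fun x => ?_⟩
  simpa [simpleIntegral_add] using (hu' x).add (hv' x)

theorem HasIntegral.bounded {f : S → ℂ} {U : F →L[ℂ] F} (hf : m.HasIntegral f U) :
    ∃ K : ℝ, 0 ≤ K ∧ ∀ s, ‖f s‖ ≤ K := by
  obtain ⟨u, hu, -⟩ := hf
  obtain ⟨n, hn⟩ := (Metric.tendstoUniformly_iff.1 hu 1 one_pos).exists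
  obtain ⟨C, hC⟩ := (u n).exists_forall_norm_le
  refine ⟨|C| + 1, by positivity, fun s => ?_⟩
  have h1 := hn s
  rw [dist_eq_norm] at h1
  have h2 := norm_add_le (f s - u n s) (u n s)
  rw [sub_add_cancel] at h2
  linarith [hC s, le_abs_self C]

theorem HasIntegral.seminorm_le {f : S → ℂ} {U : F →L[ℂ] F} (hf : m.HasIntegral f U)
    {p q : Seminorm ℂ F} (hp : Continuous p)
    (hpq : ∀ A : Set S, MeasurableSet A → ∀ x : F, p (m.toFun A x) ≤ q x)
    {K : ℝ} (hK : 0 ≤ K) (hfK : ∀ s, ‖f s‖ ≤ K) (x : F) : p (U x) ≤ 4 * K * q x := by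
  obtain ⟨u, hu, hu'⟩ := hf
  -- The approximants are bounded by `K + ε` only. Letting `ε` tend to zero admits `K = 0`, on which
  -- uniqueness of the integral rests.
  have key : ∀ ε : ℝ, 0 < ε → p (U x) ≤ 4 * (K + ε) * q x := fun ε hε => by
    refine le_of_tendsto ((hp.tendsto _).comp (hu' x)) ?_
    filter_upwards [Metric.tendstoUniformly_iff.1 hu ε hε] with n hn
    refine m.seminorm_simpleIntegral_le hpq _ (by positivity) (fun s => ?_) x
    have h1 := hn s
    rw [dist_comm, dist_eq_norm] at h1
    have h2 := norm_add_le (u n s - f s) (f s)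
    rw [sub_add_cancel] at h2
    linarith [hfK s]
  have hlim : Tendsto (fun ε : ℝ => 4 * (K + ε) * q x) (𝓝[>] 0) (𝓝 (4 * (K + 0) * q x)) :=
    (Continuous.tendsto (by fun_prop) 0).mono_left nhdsWithin_le_nhds
  rw [add_zero] at hlim
  exact ge_of_tendsto hlim (eventually_mem_nhdsWithin.mono fun ε hε => key ε hε)

theorem HasIntegral.mul (hm : m.IsEquicontinuous) {f g : S → ℂ} {U V : F →L[ℂ] F}
    (hf : m.HasIntegral f U) (hg : m.HasIntegral g V) :
    m.HasIntegral (fun s => f s * g s) (U * V) := by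
  obtain ⟨K, hK, hfK⟩ := hf.bounded
  obtain ⟨L, hL, hgL⟩ := hg.bounded
  obtain ⟨u, hu, hu'⟩ := hf
  obtain ⟨v, hv, hv'⟩ := hg
  have hbd : ∀ᶠ n in atTop, ∀ s, ‖u n s‖ ≤ K + 1 := by
    filter_upwards [Metric.tendstoUniformly_iff.1 hu 1 one_pos] with n hn s
    have h1 := hn s
    rw [dist_comm, dist_eq_norm] at h1
    have h2 := norm_add_le (u n s - f s) (f s)
    rw [sub_add_cancel] at h2
    linarith [hfK s]
  refine ⟨fun n => u n * v n, ?_, fun x => ?_⟩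
  · rw [Metric.tendstoUniformly_iff]
    intro ε hε
    have hδ : 0 < ε / (K + L + 2) := by positivity
    filter_upwards [Metric.tendstoUniformly_iff.1 hu _ hδ, Metric.tendstoUniformly_iff.1 hv _ hδ,
      hbd] with n hun hvn hb s
    rw [dist_eq_norm, SimpleFunc.mul_apply,
      show f s * g s - u n s * v n s = (f s - u n s) * g s + u n s * (g s - v n s) by ring]
    have h1 := hun s
    have h2 := hvn s
    rw [dist_eq_norm] at h1 h2
    calc _ ≤ ‖f s - u n s‖ * ‖g s‖ + ‖u n s‖ * ‖g s - v n s‖ := by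
          rw [← norm_mul, ← norm_mul]; exact norm_add_le _ _
      _ ≤ ε / (K + L + 2) * L + (K + 1) * (ε / (K + L + 2)) := by
          gcongr
          · exact hgL s
          · exact hb s
      _ < ε := by
          rw [show ε / (K + L + 2) * L + (K + 1) * (ε / (K + L + 2)) =
            ε * ((K + L + 1) / (K + L + 2)) by ring]
          refine mul_lt_of_lt_one_right hε ((div_lt_one (by positivity)).2 (by linarith))
  · simp only [simpleIntegral_mul]
    -- The integrals of the `u n` are eventually equicontinuous, so they preserve the convergence of
    -- the integrals of the `v n` at `x`.
    have h1 : Tendsto (fun n => m.simpleIntegral (u n) (m.simpleIntegral (v n) x - V x)) atTop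
        (𝓝 0) := by
      rw [tendsto_iff_seminorm]
      intro p hp
      obtain ⟨q, hq, hpq⟩ := hm p hp
      have h2 := (tendsto_iff_seminorm.1 (hv' x) q hq).const_mul (4 * (K + 1))
      rw [mul_zero] at h2
      refine squeeze_zero' (Eventually.of_forall fun _ => apply_nonneg _ _) ?_ h2
      filter_upwards [hbd] with n hb
      rw [sub_zero]
      exact m.seminorm_simpleIntegral_le hpq _ (by positivity) hb _
    have h2 := h1.add (hu' (V x))
    simpa using h2

theorem HasIntegral.smul (c : ℂ) {f : S → ℂ} {U : F →L[ℂ] F} (hf : m.HasIntegral f U) :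
    m.HasIntegral (fun s => c * f s) (c • U) := by
  obtain ⟨u, hu, hu'⟩ := hf
  refine ⟨fun n => c • u n, ?_, fun x => ?_⟩
  · rw [Metric.tendstoUniformly_iff] at hu ⊢
    intro ε hε
    filter_upwards [hu (ε / (‖c‖ + 1)) (by positivity)] with n hn s
    have h1 := hn s
    rw [dist_eq_norm] at h1 ⊢
    rw [SimpleFunc.coe_smul, Pi.smul_apply, smul_eq_mul, ← mul_sub, norm_mul]
    rw [lt_div_iff₀ (by positivity)] at h1
    nlinarith [norm_nonneg (f s - u n s)]
  · simpa [simpleIntegral_smul] using (hu' x).const_smul c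

theorem HasIntegral.sub {f g : S → ℂ} {U V : F →L[ℂ] F} (hf : m.HasIntegral f U)
    (hg : m.HasIntegral g V) : m.HasIntegral (fun s => f s - g s) (U - V) := by
  have := hf.add (hg.smul (-1))
  rw [neg_one_smul, ← sub_eq_add_neg] at this
  exact this.congr fun s => by ring

theorem HasIntegral.pow (hm : m.IsEquicontinuous) {f : S → ℂ} {U : F →L[ℂ] F}
    (hf : m.HasIntegral f U) (n : ℕ) : m.HasIntegral (fun s => f s ^ n) (U ^ n) := by
  induction n with
  | zero => simpa using m.hasIntegral_const 1
  | succ n ih =>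
    rw [pow_succ]
    exact (ih.mul hm hf).congr fun s => pow_succ _ _

theorem HasIntegral.sum {ι : Type*} (t : Finset ι) {f : ι → S → ℂ} {U : ι → F →L[ℂ] F}
    (hf : ∀ i ∈ t, m.HasIntegral (f i) (U i)) :
    m.HasIntegral (fun s => ∑ i ∈ t, f i s) (∑ i ∈ t, U i) := by
  classical
  induction t using Finset.induction_on with
  | empty => simpa using m.hasIntegral_const 0
  | insert a t ha ih =>
    rw [Finset.sum_insert ha]
    exact ((hf a (by simp)).add (ih fun i hi => hf i (by simp [hi]))).congr
      fun s => Finset.sum_insert ha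

theorem HasIntegral.unique (hm : m.IsEquicontinuous) {f : S → ℂ} {U V : F →L[ℂ] F}
    (hf : m.HasIntegral f U) (hg : m.HasIntegral f V) : U = V := by
  ext x
  refine sub_eq_zero.1 (eq_zero_of_forall_seminorm _ fun p hp => ?_)
  obtain ⟨q, hq, hpq⟩ := hm p hp
  have := (hf.sub hg).seminorm_le hp hpq le_rfl (by simp) x
  exact le_antisymm (by simpa using this) (apply_nonneg _ _)

theorem HasIntegral.commute (hm : m.IsEquicontinuous) {f g : S → ℂ} {U V : F →L[ℂ] F}
    (hf : m.HasIntegral f U) (hg : m.HasIntegral g V) : Commute U V :=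
  (hf.mul hm hg).unique hm ((hg.mul hm hf).congr fun _ => mul_comm _ _)

end OperatorSpectralMeasure

/-- A bounded measurable function is a uniform limit of simple functions. -/
theorem MeasureTheory.exists_simpleFunc_norm_sub_le {S : Type*} [MeasurableSpace S] {h : S → ℂ}
    (hh : Measurable h) {K : ℝ} (hK : ∀ s, ‖h s‖ ≤ K) {ε : ℝ} (hε : 0 < ε) :
    ∃ g : SimpleFunc S ℂ, ∀ s, ‖h s - g s‖ ≤ ε := by
  obtain ⟨t, ht⟩ := (isCompact_closedBall (0 : ℂ) K).elim_finite_subcover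
    (fun k => Metric.ball (TopologicalSpace.denseSeq ℂ k) ε) (fun _ => Metric.isOpen_ball)
    fun z _ => by
      obtain ⟨k, hk⟩ := (TopologicalSpace.denseRange_denseSeq ℂ).exists_dist_lt z hε
      exact Set.mem_iUnion.2 ⟨k, hk⟩
  -- The nearest point among the indices up to `t.sup id` is at least as near as the centre of the
  -- ball of the cover containing `h s`.
  refine ⟨(SimpleFunc.nearestPt (TopologicalSpace.denseSeq ℂ) (t.sup id)).comp h hh, fun s => ?_⟩
  obtain ⟨k, hkt, hk⟩ := Set.mem_iUnion₂.1 (ht (mem_closedBall_zero_iff.2 (hK s)))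
  have h1 := SimpleFunc.edist_nearestPt_le (TopologicalSpace.denseSeq ℂ) (h s)
    (Finset.le_sup (f := id) hkt)
  rw [edist_dist, edist_dist, ENNReal.ofReal_le_ofReal_iff dist_nonneg] at h1
  rw [← dist_eq_norm, dist_comm]
  refine (h1.trans ?_).trans (Metric.mem_ball.1 hk).le
  rw [dist_comm]; rfl

/-! ### Eigenspaces and the mean ergodic theorem -/

namespace OperatorSpectralMeasure

open MeasureTheory

variable {F : Type*} [AddCommGroup F] [Module ℂ F] [TopologicalSpace F]
  [IsTopologicalAddGroup F] [ContinuousSMul ℂ F] [PolynormableSpace ℂ F] [T2Space F]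
  {S : Type*} [MeasurableSpace S] {m : OperatorSpectralMeasure S F}

/-- On a set on which `f` stays away from `ξ`, the operator `ξ - U` is approximately invertible. -/
theorem exists_approx_inverse (hm : m.IsEquicontinuous) {f : S → ℂ} (hf : Measurable f)
    {U : F →L[ℂ] F} (hU : m.HasIntegral f U) {D : Set S} (hD : MeasurableSet D) {ξ : ℂ} {δ : ℝ}
    (hδ : 0 < δ) (hfD : ∀ s ∈ D, δ ≤ ‖ξ - f s‖) {p : Seminorm ℂ F} (hp : Continuous p) (x : F)
    {ε : ℝ} (hε : 0 < ε) :
    ∃ V : F →L[ℂ] F, Commute V (ξ • 1 - U) ∧ p (V ((ξ • (1 : F →L[ℂ] F) - U) x) - m.toFun D x) < ε := by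
  obtain ⟨q, hq, hpq⟩ := hm p hp
  obtain ⟨K, hK, hfK⟩ := hU.bounded
  have hmeas : Measurable (D.indicator fun s => (ξ - f s)⁻¹) :=
    ((measurable_const.sub hf).inv).indicator hD
  have hbd : ∀ s, ‖D.indicator (fun s => (ξ - f s)⁻¹) s‖ ≤ δ⁻¹ := fun s => by
    by_cases hs : s ∈ D
    · rw [Set.indicator_of_mem hs, norm_inv]
      exact inv_anti₀ hδ (hfD s hs)
    · rw [Set.indicator_of_notMem hs, norm_zero]; positivity
  set L := ‖ξ‖ + K + 1
  have hL : 0 < L := by positivity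
  have hq0 : 0 ≤ q x := apply_nonneg _ _
  set η := ε / (4 * L * (q x + 1))
  have hη : 0 < η := by positivity
  -- As `L` bounds `|ξ - f|`, the product `h * (ξ - f)` differs from `1_D` by at most `η L`; `η`
  -- makes `4 η L q x < ε`.
  obtain ⟨h, hh⟩ := exists_simpleFunc_norm_sub_le hmeas hbd hη
  have hξU := (m.hasIntegral_const ξ).sub hU
  have hJ := m.hasIntegral_simpleFunc h
  refine ⟨m.simpleIntegral h, hJ.commute hm hξU, ?_⟩
  have hI := (hJ.mul hm hξU).sub (m.hasIntegral_indicator hD)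
  have hle := hI.seminorm_le hp hpq (K := η * L) (by positivity) (fun s => ?_) x
  · refine lt_of_le_of_lt hle ?_
    calc 4 * (η * L) * q x = ε * (q x / (q x + 1)) := by
          simp only [η]; field_simp
      _ < ε := mul_lt_of_lt_one_right hε ((div_lt_one (by positivity)).2 (by linarith))
  · have e : D.indicator (fun _ => (1 : ℂ)) s = D.indicator (fun s => (ξ - f s)⁻¹) s * (ξ - f s) := by
      by_cases hs : s ∈ D
      · rw [Set.indicator_of_mem hs, Set.indicator_of_mem hs, inv_mul_cancel₀]
        exact norm_pos_iff.1 (hδ.trans_le (hfD s hs))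
      · rw [Set.indicator_of_notMem hs, Set.indicator_of_notMem hs, zero_mul]
    rw [e, ← sub_mul, norm_mul, norm_sub_rev]
    gcongr
    · exact hh s
    · exact (norm_sub_le _ _).trans (by linarith [hfK s])

/-- If a functional annihilates `m A x` for all `A` on which `f` stays away from `ξ`, it
annihilates `m {f ≠ ξ} x`. -/
theorem dual_toFun_ne_eq_zero {f : S → ℂ} (hf : Measurable f) (ξ : ℂ) (x : F) (y : F →L[ℂ] ℂ)
    (h : ∀ D, MeasurableSet D → ∀ δ > 0, (∀ s ∈ D, δ ≤ ‖ξ - f s‖) → y (m.toFun D x) = 0) :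
    y (m.toFun (f ⁻¹' {ξ})ᶜ x) = 0 := by
  -- These sets exhaust `{f ≠ ξ}`; made disjoint, they allow weak countable additivity to be used.
  let A : ℕ → Set S := fun k => {s | 1 / ((k : ℝ) + 1) ≤ ‖ξ - f s‖}
  have hA : ∀ k, MeasurableSet (A k) := fun k =>
    measurableSet_le measurable_const (measurable_const.sub hf).norm
  have hU : (f ⁻¹' {ξ})ᶜ = ⋃ k, disjointed A k := by
    rw [iUnion_disjointed]
    ext s
    simp only [Set.mem_compl_iff, Set.mem_preimage, Set.mem_singleton_iff, Set.mem_iUnion, A,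
      Set.mem_ofPred_eq]
    constructor
    · intro hs
      obtain ⟨k, hk⟩ := exists_nat_one_div_lt (norm_pos_iff.2 (sub_ne_zero.2 (Ne.symm hs)))
      exact ⟨k, hk.le⟩
    · rintro ⟨k, hk⟩ hs
      rw [hs, sub_self, norm_zero] at hk
      exact absurd hk (not_le.2 (by positivity))
  have hs := m.hasSum_iUnion (disjointed A) (fun k => .disjointed hA k)
    (disjoint_disjointed A) x y
  rw [← hU] at hs
  refine hs.unique ?_
  convert! hasSum_zero with k
  exact h _ (.disjointed hA k) (1 / (k + 1)) (by positivity) fun s hs => disjointed_subset A k hs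

/-- A functional vanishing on the range of `ξ - U` kills `V (ξ - U) x = (ξ - U) V x`, which
approximates `m D x`. -/
theorem toFun_ne_mem_closure_range (hm : m.IsEquicontinuous) {f : S → ℂ} (hf : Measurable f)
    {U : F →L[ℂ] F} (hU : m.HasIntegral f U) (ξ : ℂ) (x : F) :
    m.toFun (f ⁻¹' {ξ})ᶜ x ∈ closure (Set.range (ξ • (1 : F →L[ℂ] F) - U)) := by
  refine mem_closure_of_forall_dual (ξ • (1 : F →L[ℂ] F) - U).range _ fun y hy => ?_
  refine dual_toFun_ne_eq_zero hf ξ x y fun D hD δ hδ hfD => ?_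
  by_contra hne
  obtain ⟨V, hVU, hV⟩ := exists_approx_inverse hm hf hU hD hδ hfD (p := y.toSeminorm)
    y.continuous.norm x (norm_pos_iff.2 hne)
  have h1 : V ((ξ • (1 : F →L[ℂ] F) - U) x) = (ξ • (1 : F →L[ℂ] F) - U) (V x) :=
    congrArg (fun T : F →L[ℂ] F => T x) hVU.eq
  have h2 : y (V ((ξ • (1 : F →L[ℂ] F) - U) x)) = 0 := by
    rw [h1]; exact hy _ ⟨_, rfl⟩
  have h3 : ‖y (V ((ξ • (1 : F →L[ℂ] F) - U) x) - m.toFun D x)‖ < ‖y (m.toFun D x)‖ := hV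
  rw [map_sub, h2, zero_sub, norm_neg] at h3
  exact lt_irrefl _ h3

theorem apply_toFun_preimage_singleton (hm : m.IsEquicontinuous) {f : S → ℂ} (hf : Measurable f)
    {U : F →L[ℂ] F} (hU : m.HasIntegral f U) (ξ : ℂ) (x : F) :
    U (m.toFun (f ⁻¹' {ξ}) x) = ξ • m.toFun (f ⁻¹' {ξ}) x := by
  have hI := m.hasIntegral_indicator (hf (measurableSet_singleton ξ))
  have : U * m.toFun (f ⁻¹' {ξ}) = ξ • m.toFun (f ⁻¹' {ξ}) := by
    refine (hU.mul hm hI).unique hm ((hI.smul ξ).congr fun s => ?_)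
    by_cases hs : s ∈ f ⁻¹' {ξ}
    · rw [show f s = ξ from hs]
    · rw [Set.indicator_of_notMem hs, mul_zero, mul_zero]
  exact congrArg (fun T : F →L[ℂ] F => T x) this

theorem range_resolution_singleton (hm : m.IsEquicontinuous) {f : S → ℂ} (hf : Measurable f)
    {U : F →L[ℂ] F} (hU : m.HasIntegral f U) (ξ : ℂ) :
    Set.range (m.resolution f {ξ}) = {ψ : F | U ψ = ξ • ψ} := by
  ext ψ
  simp only [Set.mem_range, Set.mem_ofPred_eq, resolution]
  constructor
  · rintro ⟨x, rfl⟩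
    exact apply_toFun_preimage_singleton hm hf hU ξ x
  · intro hψ
    refine ⟨ψ, ?_⟩
    -- Approximate inverses map `(ξ - U) ψ = 0` to zero, so `m D ψ` vanishes whenever `f` stays away
    -- from `ξ` on `D`.
    have h0 : m.toFun (f ⁻¹' {ξ})ᶜ ψ = 0 := by
      refine eq_zero_of_forall_dual _ fun y => ?_
      refine dual_toFun_ne_eq_zero hf ξ ψ y fun D hD δ hδ hfD => ?_
      by_contra hne
      obtain ⟨V, -, hV⟩ := exists_approx_inverse hm hf hU hD hδ hfD (p := y.toSeminorm)
        y.continuous.norm ψ (norm_pos_iff.2 hne)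
      have h1 : (ξ • (1 : F →L[ℂ] F) - U) ψ = 0 := by simp [hψ]
      have h3 : ‖y (V ((ξ • (1 : F →L[ℂ] F) - U) ψ) - m.toFun D ψ)‖ < ‖y (m.toFun D ψ)‖ := hV
      rw [h1, map_zero, zero_sub, map_neg, norm_neg] at h3
      exact lt_irrefl _ h3
    rw [m.toFun_compl (hf (measurableSet_singleton ξ))] at h0
    exact (sub_eq_zero.1 (by simpa using h0)).symm

/-- The mean ergodic theorem for operators which are integrals of functions bounded by one. -/
theorem tendsto_opAverage (hm : m.IsEquicontinuous) {g : S → ℂ} (hg : Measurable g)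
    (hg1 : ∀ s, ‖g s‖ ≤ 1) {T : F →L[ℂ] F} (hT : m.HasIntegral g T) (ψ : F) :
    Tendsto (fun n : ℕ => opAverage n T ψ) atTop (𝓝 (m.toFun (g ⁻¹' {1}) ψ)) := by
  have hP := hg (measurableSet_singleton (1 : ℂ))
  have havg : ∀ n : ℕ, m.HasIntegral (fun s => (n : ℂ)⁻¹ * ∑ k ∈ Finset.range n, g s ^ k)
      (opAverage n T) := fun n => (HasIntegral.sum _ fun k _ => hT.pow hm k).smul _
  -- All averages have integrands of modulus at most one and are therefore equicontinuous.
  have havg1 : ∀ (n : ℕ) s, ‖(n : ℂ)⁻¹ * ∑ k ∈ Finset.range n, g s ^ k‖ ≤ 1 := fun n s => by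
    have h1 : ‖∑ k ∈ Finset.range n, g s ^ k‖ ≤ n := by
      refine (norm_sum_le _ _).trans ?_
      refine (Finset.sum_le_card_nsmul _ _ 1 fun k _ => ?_).trans (by simp)
      rw [norm_pow]
      exact pow_le_one₀ (norm_nonneg _) (hg1 s)
    rw [norm_mul, norm_inv, Complex.norm_natCast]
    exact (mul_le_mul_of_nonneg_left h1 (by positivity)).trans (inv_mul_le_one)
  have hfix : Tendsto (fun n : ℕ => opAverage n T (m.toFun (g ⁻¹' {1}) ψ)) atTop
      (𝓝 (m.toFun (g ⁻¹' {1}) ψ)) := by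
    have h1 := apply_toFun_preimage_singleton hm hg hT 1 ψ
    rw [one_smul] at h1
    have hk : ∀ k, (T ^ k) (m.toFun (g ⁻¹' {1}) ψ) = m.toFun (g ⁻¹' {1}) ψ := fun k => by
      induction k with
      | zero => simp
      | succ k ih => rw [pow_succ, mul_apply_eq_comp, h1, ih]
    refine tendsto_const_nhds.congr' ?_
    filter_upwards [eventually_ne_atTop 0] with n hn
    rw [opAverage, smul_apply, sum_apply]
    simp only [hk, Finset.sum_const, Finset.card_range]
    rw [← Nat.cast_smul_eq_nsmul ℂ, smul_smul, inv_mul_cancel₀ (by exact_mod_cast hn), one_smul]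
  have hran : Tendsto (fun n : ℕ => opAverage n T (m.toFun (g ⁻¹' {1})ᶜ ψ)) atTop (𝓝 0) := by
    have hcl := toFun_ne_mem_closure_range hm hg hT 1 ψ
    set φ := m.toFun (g ⁻¹' {1})ᶜ ψ
    rw [tendsto_iff_seminorm]
    intro p hp
    obtain ⟨q, hq, hpq⟩ := hm p hp
    simp only [sub_zero]
    rw [Metric.tendsto_nhds]
    intro ε hε
    -- The factor 4 of the seminorm bound turns `ε / 8` into `ε / 2`; the other half is left for the
    -- telescoped term on `(1 - T) w`.
    obtain ⟨_, ⟨w, rfl⟩, hw⟩ := exists_seminorm_sub_lt_of_mem_closure hcl hq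
      (show 0 < ε / 8 by positivity)
    rw [one_smul] at hw
    have hlim : Tendsto (fun n : ℕ => (n : ℝ)⁻¹ * (p w + 4 * q w)) atTop (𝓝 0) := by
      simpa using (tendsto_inv_atTop_nhds_zero_nat (𝕜 := ℝ)).mul_const (p w + 4 * q w)
    filter_upwards [hlim.eventually (gt_mem_nhds (show 0 < ε / 2 by positivity))] with n hn
    rw [Real.dist_eq, sub_zero, abs_of_nonneg (apply_nonneg _ _)]
    have h1 : opAverage n T φ = opAverage n T (φ - (1 - T) w) + (n : ℂ)⁻¹ • (w - (T ^ n) w) := by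
      have : opAverage n T ((1 - T) w) = (n : ℂ)⁻¹ • (w - (T ^ n) w) := by
        have h2 := congrArg (fun A : F →L[ℂ] F => A w) (geom_sum_mul_neg T n)
        simp only [mul_apply_eq_comp] at h2
        rw [opAverage, smul_apply, h2]
        simp
      rw [← this, ← map_add, sub_add_cancel]
    rw [h1]
    refine (map_add_le_add p _ _).trans_lt ?_
    have h2 := (havg n).seminorm_le hp hpq zero_le_one (havg1 n) (φ - (1 - T) w)
    have h3 := (hT.pow hm n).seminorm_le hp hpq zero_le_one (fun s => by
      rw [norm_pow]; exact pow_le_one₀ (norm_nonneg _) (hg1 s)) w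
    have h4 : p ((n : ℂ)⁻¹ • (w - (T ^ n) w)) ≤ (n : ℝ)⁻¹ * (p w + 4 * q w) := by
      rw [map_smul_eq_mul, norm_inv, Complex.norm_natCast]
      gcongr
      exact (map_sub_le_add p _ _).trans (by linarith)
    linarith
  have := hfix.add hran
  simp only [← map_add, add_zero] at this
  rw [m.toFun_compl hP] at this
  simpa using this

end OperatorSpectralMeasure

/-! ### Divergent characters for atomless measures -/

section MeasureTheory

open MeasureTheory ProbabilityTheory FourierTransform

/-- The characters `t ↦ exp (-2πi k n t)` along a strictly monotone sequence diverge almost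
everywhere. -/
theorem volume_setOf_tendsto_fourierChar (φ : ℕ → ℕ) (hφ : StrictMono φ) :
    volume {t : ℝ | ∃ c : ℂ, Tendsto (fun n => ((𝐞 (-(t * φ n)) : Circle) : ℂ)) atTop (𝓝 c)} = 0 := by
  set u : ℕ → ℝ → ℂ := fun n t => ((𝐞 (-(t * φ n)) : Circle) : ℂ)
  have hu : ∀ n, Measurable (u n) := fun n => by
    have : Continuous (u n) := continuous_subtype_val.comp
      (Real.continuous_fourierChar.comp (by fun_prop))
    exact this.measurable
  have hu1 : ∀ n t, ‖u n t‖ = 1 := fun n t => Circle.norm_coe _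
  set E := {t : ℝ | ∃ c : ℂ, Tendsto (fun n => u n t) atTop (𝓝 c)}
  have hE : MeasurableSet E := measurableSet_exists_tendsto hu
  suffices h : ∀ k : ℕ, volume (E ∩ Metric.closedBall 0 k) = 0 by
    have hcov : E = ⋃ k : ℕ, E ∩ Metric.closedBall 0 (k : ℝ) := by
      rw [← Set.inter_iUnion, Metric.iUnion_closedBall_nat, Set.inter_univ]
    rw [hcov]
    exact measure_iUnion_null h
  intro k
  set A := E ∩ Metric.closedBall 0 (k : ℝ)
  have hA : MeasurableSet A := hE.inter measurableSet_closedBall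
  have hAfin : volume A < ⊤ :=
    (measure_mono Set.inter_subset_right).trans_lt measure_closedBall_lt_top
  choose! s hs using fun t (ht : t ∈ E) => ht
  have hlim : ∀ t, Tendsto (fun n => A.indicator (u n) t) atTop (𝓝 (A.indicator s t)) := fun t => by
    by_cases ht : t ∈ A
    · simpa [ht] using hs t ht.1
    · simp [ht]
  have hmeas : Measurable (A.indicator s) :=
    measurable_of_tendsto_metrizable (fun n => (hu n).indicator hA) (tendsto_pi_nhds.2 hlim)
  -- Limits of characters have modulus one, so multiplying by the conjugate limit turns the
  -- integrands into ones tending to `1` on `A`.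
  have hnorm : ∀ t ∈ A, ‖s t‖ = 1 := fun t ht =>
    tendsto_nhds_unique (hs t ht.1).norm (by simp [hu1])
  set h : ℝ → ℂ := fun t => (starRingEnd ℂ) (A.indicator s t)
  have hh : Measurable h := Complex.continuous_conj.measurable.comp hmeas
  have h1 : Tendsto (fun n => ∫ t, u n t * h t) atTop (𝓝 (∫ t, A.indicator (fun _ => (1 : ℂ)) t)) := by
    refine tendsto_integral_of_dominated_convergence (A.indicator fun _ => (1 : ℝ))
      (fun n => ((hu n).mul hh).aestronglyMeasurable)
      ((integrable_indicator_iff hA).2 (integrableOn_const hAfin.ne))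
      (fun n => ae_of_all _ fun t => ?_) (ae_of_all _ fun t => ?_)
    · by_cases ht : t ∈ A
      · simp [h, hu1, ht, hnorm t ht]
      · simp [h, ht]
    · by_cases ht : t ∈ A
      · have := (hs t ht.1).mul_const (h t)
        have e : s t * h t = 1 := by
          simp only [h, Set.indicator_of_mem ht]
          rw [Complex.mul_conj, Complex.normSq_eq_norm_sq, hnorm t ht]; simp
        rw [e] at this
        simpa [ht] using this
      · simp [h, ht]
  -- By the Riemann-Lebesgue lemma the same integrals tend to zero, so `A` is null.
  have h2 : Tendsto (fun n => ∫ t, u n t * h t) atTop (𝓝 0) := by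
    have hc : Tendsto (fun n => (φ n : ℝ)) atTop (cocompact ℝ) :=
      (tendsto_natCast_atTop_atTop.comp hφ.tendsto_atTop).mono_right atTop_le_cocompact
    exact (Real.tendsto_integral_exp_smul_cocompact h).comp hc
  have h3 := tendsto_nhds_unique h1 h2
  rw [integral_indicator hA, setIntegral_const, smul_eq_zero] at h3
  have h4 := h3.resolve_right one_ne_zero
  exact (measureReal_eq_zero_iff hAfin.ne).1 h4

theorem continuous_cdf (μ : Measure ℝ) [IsProbabilityMeasure μ] [NullSingletonClass μ] :
    Continuous (cdf μ) := by
  rw [continuous_iff_continuousAt]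
  intro t
  rw [(monotone_cdf μ).continuousAt_iff_leftLim_eq_rightLim, (cdf μ).rightLim_eq]
  have h := (cdf μ).measure_singleton t
  rw [measure_cdf, measure_singleton] at h
  have h1 := ENNReal.ofReal_eq_zero.1 h.symm
  exact le_antisymm ((monotone_cdf μ).leftLim_le le_rfl) (by linarith)

/-- Without atoms the distribution function is continuous and attains every value in `(0, 1)`. This
transports Lebesgue-almost-everywhere divergence to arbitrary atomless measures. -/
theorem map_cdf_eq (μ : Measure ℝ) [IsProbabilityMeasure μ] [NullSingletonClass μ] :
    μ.map (cdf μ) = volume.restrict (Set.Icc 0 1) := by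
  have hG := continuous_cdf μ
  have : IsProbabilityMeasure (μ.map (cdf μ)) := Measure.isProbabilityMeasure_map hG.aemeasurable
  have hiv : ∀ a, 0 < a → a < 1 → ∃ t, cdf μ t = a := fun a h0 h1 =>
    mem_range_of_exists_le_of_exists_ge hG
      (((tendsto_cdf_atBot μ).eventually (gt_mem_nhds h0)).exists.imp fun _ h => h.le)
      (((tendsto_cdf_atTop μ).eventually (lt_mem_nhds h1)).exists.imp fun _ h => h.le)
  refine Measure.ext_of_Iic _ _ fun a => ?_
  rw [Measure.map_apply hG.measurable measurableSet_Iic, Measure.restrict_apply measurableSet_Iic]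
  rcases lt_or_ge a 0 with ha | ha
  · rw [show cdf μ ⁻¹' Set.Iic a = ∅ from ?_, show Set.Iic a ∩ Set.Icc 0 1 = ∅ from ?_]
    · simp
    · ext t; simp; intros; linarith
    · ext t; simp; linarith [cdf_nonneg μ t]
  rcases le_or_gt 1 a with ha1 | ha1
  · rw [show cdf μ ⁻¹' Set.Iic a = Set.univ from ?_, show Set.Iic a ∩ Set.Icc 0 1 = Set.Icc 0 1 from ?_]
    · simp
    · ext t; simp; intros; linarith
    · ext t; simp; linarith [cdf_le_one μ t]
  rw [show Set.Iic a ∩ Set.Icc 0 1 = Set.Icc 0 a from ?_, Real.volume_Icc, sub_zero]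
  · refine le_antisymm ?_ ?_
    · have hup : ∀ b ∈ Set.Ioo a 1, μ (cdf μ ⁻¹' Set.Iic a) ≤ ENNReal.ofReal b := fun b hb => by
        obtain ⟨t, rfl⟩ := hiv b (ha.trans_lt hb.1) hb.2
        rw [ofReal_cdf]
        refine measure_mono fun r hr => ?_
        by_contra hlt
        exact absurd ((monotone_cdf μ) (not_le.1 hlt).le) (not_le.2 ((show cdf μ r ≤ a from hr).trans_lt hb.1))
      refine ge_of_tendsto ((ENNReal.continuous_ofReal.tendsto a).mono_left
        (nhdsWithin_le_nhds (s := Set.Ioi a))) ?_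
      filter_upwards [Ioo_mem_nhdsGT ha1] with b hb using hup b hb
    · rcases ha.eq_or_lt with rfl | ha0
      · simp
      obtain ⟨t, rfl⟩ := hiv a ha0 ha1
      rw [ofReal_cdf]
      exact measure_mono fun r hr => (monotone_cdf μ) hr
  · ext t; simp; constructor
    · rintro ⟨h1, h2, h3⟩; exact ⟨h2, h1⟩
    · rintro ⟨h1, h2⟩; exact ⟨h2, h1, by linarith⟩

/-- For a finite measure without atoms there is a function whose characters diverge almost
everywhere along each subsequence. -/
theorem exists_measurable_fourierChar_diverges {X : Type*} [MeasurableSpace X] [StandardBorelSpace X]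
    (ν : Measure X) [IsFiniteMeasure ν] [NullSingletonClass ν] :
    ∃ G : X → ℝ, Measurable G ∧ ∀ φ : ℕ → ℕ, StrictMono φ →
      ν {z | ∃ c : ℂ, Tendsto (fun n => ((𝐞 (-(G z * φ n)) : Circle) : ℂ)) atTop (𝓝 c)} = 0 := by
  rcases eq_or_ne ν 0 with rfl | h0
  · exact ⟨fun _ => 0, measurable_const, by simp⟩
  have : NeZero ν := ⟨h0⟩
  have he := measurableEmbedding_embeddingReal X
  set κ := (ν Set.univ)⁻¹ • ν
  set μ := κ.map (embeddingReal X)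
  have : IsProbabilityMeasure μ := Measure.isProbabilityMeasure_map he.measurable.aemeasurable
  have : NullSingletonClass μ := ⟨fun t => by
    rw [Measure.map_apply he.measurable (measurableSet_singleton t), Measure.smul_apply,
      (Set.subsingleton_singleton.preimage he.injective).measure_zero, smul_zero]⟩
  have hG : Measurable (cdf μ) := (continuous_cdf μ).measurable
  refine ⟨cdf μ ∘ embeddingReal X, hG.comp he.measurable, fun φ hφ => ?_⟩
  have h1 := volume_setOf_tendsto_fourierChar φ hφ
  have h2 : (μ.map (cdf μ)) {t : ℝ | ∃ c : ℂ,
      Tendsto (fun n => ((𝐞 (-(t * φ n)) : Circle) : ℂ)) atTop (𝓝 c)} = 0 := by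
    rw [map_cdf_eq]
    exact Measure.absolutelyContinuous_of_le Measure.restrict_le_self h1
  -- The inequality for push-forwards needs no measurability of the set of convergence.
  have h3 := (Measure.le_map_apply he.measurable.aemeasurable _).trans
    ((Measure.le_map_apply hG.aemeasurable _).trans h2.le)
  have h4 : κ _ = 0 := le_antisymm h3 bot_le
  rw [Measure.smul_apply, smul_eq_mul, mul_eq_zero] at h4
  exact h4.resolve_left (ENNReal.inv_ne_zero.2 (measure_ne_top _ _))

end MeasureTheory

open MeasureTheory in
/-- A finite measure on the plane is null on the set of points around which it decays faster than
the area. -/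
theorem ae_notMem_of_measure_closedBall_le (ν : Measure ℂ) [IsFiniteMeasure ν] (N : Set ℂ)
    (hN : ∀ ξ ∈ N, ∃ C : ℝ, ∀ r > 0, ν.real (Metric.closedBall ξ r) ≤ C * r ^ 3) :
    ∀ᵐ z ∂ν, z ∉ N := by
  -- Differentiating area by `ν`, with a density finite `ν`-almost everywhere, bounds the area of
  -- small discs by a multiple of their `ν`-measure.
  filter_upwards [Besicovitch.ae_tendsto_rnDeriv volume ν, Measure.rnDeriv_lt_top volume ν]
    with z hz hlt hzN
  obtain ⟨C, hC⟩ := hN z hzN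
  obtain ⟨L, hL, hL'⟩ := ENNReal.lt_iff_exists_nnreal_btwn.1 hlt
  have h1 : ∀ᶠ r : ℝ in 𝓝[>] 0, Real.pi ≤ L * C * r := by
    filter_upwards [hz.eventually (gt_mem_nhds hL), eventually_mem_nhdsWithin] with r hr hr0
    have hr0 : 0 < r := hr0
    have h2 := (ENNReal.div_le_iff_le_mul (Or.inr ENNReal.coe_ne_top)
      (Or.inl (measure_ne_top ν _))).1 hr.le
    have h3 := ENNReal.toReal_mono (ENNReal.mul_ne_top ENNReal.coe_ne_top (measure_ne_top ν _)) h2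
    rw [Complex.volume_closedBall, ENNReal.toReal_mul, ENNReal.toReal_mul, ENNReal.toReal_pow,
      ENNReal.toReal_ofReal hr0.le] at h3
    have h4 := hC r hr0
    have h5 : r ^ 2 * Real.pi ≤ L * (C * r ^ 3) :=
      h3.trans (mul_le_mul_of_nonneg_left h4 L.coe_nonneg)
    have hr2 : 0 < r ^ 2 := by positivity
    nlinarith
  have h2 : Tendsto (fun r : ℝ => L * C * r) (𝓝[>] 0) (𝓝 (L * C * 0)) :=
    (Continuous.tendsto (by fun_prop) 0).mono_left nhdsWithin_le_nhds
  have h3 := ge_of_tendsto h2 h1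
  rw [mul_zero] at h3
  exact absurd Real.pi_pos (not_lt.2 h3)

/-! ### Absence of a diffuse part on the eigenvalues -/

namespace OperatorSpectralMeasure

open MeasureTheory FourierTransform

variable {F : Type*} [AddCommGroup F] [Module ℂ F] [TopologicalSpace F]
  [IsTopologicalAddGroup F] [ContinuousSMul ℂ F] [PolynormableSpace ℂ F] [T2Space F]
  {S : Type*} [MeasurableSpace S] {m : OperatorSpectralMeasure S F}

theorem inter_apply (m : OperatorSpectralMeasure S F) {A B : Set S} (hA : MeasurableSet A)
    (hB : MeasurableSet B) (x : F) : m.toFun A (m.toFun B x) = m.toFun (A ∩ B) x := by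
  rw [m.inter_eq_mul A B hA hB, mul_apply_eq_comp]

theorem toFun_preimage_singleton_ne_zero_iff (hm : m.IsEquicontinuous) {f : S → ℂ}
    (hf : Measurable f) {U : F →L[ℂ] F} (hU : m.HasIntegral f U) (μ : ℂ) :
    m.toFun (f ⁻¹' {μ}) ≠ 0 ↔ μ ∈ opPointSpectrum U := by
  constructor
  · intro h
    have hinj : ¬ Function.Injective (μ • (1 : F →L[ℂ] F) - U) := fun hinj => h <| by
      ext x
      refine hinj ?_
      simp [apply_toFun_preimage_singleton hm hf hU μ x]
    exact ⟨fun hr => hinj hr.2.injective, hinj⟩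
  · rintro ⟨-, hinj⟩ h
    refine hinj ((injective_iff_map_eq_zero _).2 fun ψ hψ => ?_)
    have h1 : ψ ∈ {ψ : F | U ψ = μ • ψ} := by
      exact (sub_eq_zero.1 (by simpa using hψ)).symm
    rw [← range_resolution_singleton hm hf hU μ] at h1
    obtain ⟨x, rfl⟩ := h1
    simp [resolution, h]

/-- Around a point of the resolvent set the spectral measure decays faster than each power of the
radius. -/
theorem exists_seminorm_toFun_closedBall_le (hm : m.IsEquicontinuous) {f : S → ℂ}
    (hf : Measurable f) {U : F →L[ℂ] F} (hU : m.HasIntegral f U) {ξ : ℂ} (hξ : ξ ∉ opSpectrum U)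
    (k : ℕ) (p : Seminorm ℂ F) (hp : Continuous p) :
    ∃ q : Seminorm ℂ F, Continuous q ∧ ∀ r : ℝ, 0 ≤ r → ∀ x : F,
      p (m.toFun (f ⁻¹' Metric.closedBall ξ r) x) ≤ (4 * r) ^ k * q x := by
  induction k generalizing p with
  | zero =>
    obtain ⟨q, hq, hpq⟩ := hm p hp
    exact ⟨q, hq, fun r _ x => by simpa using hpq _ (hf measurableSet_closedBall) x⟩
  | succ k ih =>
    have hemb := (not_not.1 hξ : ξ ∈ opResolventSet U).2
    -- The continuous inverse of `ξ - U` bounds `p` by `q₁ ∘ (ξ - U)`; as `|ξ - f| ≤ r` on `D`, each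
    -- round gains a factor `4 r`.
    obtain ⟨q₁, hq₁, hpq₁⟩ := Seminorm.exists_le_comp_of_isInducing
      (f := ((ξ • (1 : F →L[ℂ] F) - U : F →L[ℂ] F) : F →ₗ[ℂ] F)) hp hemb.isInducing
    obtain ⟨q₂, hq₂, hq₁₂⟩ := ih q₁ hq₁
    obtain ⟨q₃, hq₃, hq₂₃⟩ := hm q₂ hq₂
    refine ⟨q₃, hq₃, fun r hr x => ?_⟩
    have hD := hf (measurableSet_closedBall (x := ξ) (ε := r))
    set D := f ⁻¹' Metric.closedBall ξ r
    have hI := m.hasIntegral_indicator hD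
    have hξU := (m.hasIntegral_const ξ).sub hU
    have hVD := hξU.mul hm hI
    have h1 : m.toFun D (((ξ • (1 : F →L[ℂ] F) - U) * m.toFun D) x) =
        (ξ • (1 : F →L[ℂ] F) - U) (m.toFun D x) := by
      have h2 := congrArg (fun T : F →L[ℂ] F => T x) (hI.commute hm hVD).eq
      simp only [mul_apply_eq_comp] at h2 ⊢
      rw [h2, inter_apply m hD hD, Set.inter_self]
    calc p (m.toFun D x) ≤ q₁ ((ξ • (1 : F →L[ℂ] F) - U) (m.toFun D x)) := hpq₁ _
      _ ≤ (4 * r) ^ k * q₂ (((ξ • (1 : F →L[ℂ] F) - U) * m.toFun D) x) := by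
        rw [← h1]; exact hq₁₂ r hr _
      _ ≤ (4 * r) ^ k * (4 * r * q₃ x) := by
        gcongr
        refine hVD.seminorm_le hq₂ hq₂₃ hr (fun s => ?_) x
        by_cases hs : s ∈ D
        · rw [Set.indicator_of_mem hs, mul_one, ← dist_eq_norm, dist_comm]
          exact hs
        · rw [Set.indicator_of_notMem hs, mul_zero, norm_zero]
          exact hr
      _ = (4 * r) ^ (k + 1) * q₃ x := by ring

/-- In a separable and locally sequentially weakly compact space, a finite measure without atoms
does not see the points that carry a nonzero spectral projection. -/
theorem measure_setOf_toFun_preimage_singleton_ne_zero [TopologicalSpace.SeparableSpace F]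
    (hF : LocallySeqWeaklyCompact F) (hm : m.IsEquicontinuous) {f : S → ℂ} (hf : Measurable f)
    (ν : Measure ℂ) [IsFiniteMeasure ν] [NullSingletonClass ν] :
    ν {z | m.toFun (f ⁻¹' {z}) ≠ 0} = 0 := by
  have : Nonempty F := ⟨0⟩
  obtain ⟨G, hG, hGν⟩ := exists_measurable_fourierChar_diverges ν
  have hsub : {z | m.toFun (f ⁻¹' {z}) ≠ 0} ⊆
      ⋃ n, {z | m.toFun (f ⁻¹' {z}) (TopologicalSpace.denseSeq F n) ≠ 0} := by
    intro z hz
    by_contra hcon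
    simp only [Set.mem_iUnion, Set.mem_ofPred_eq, not_exists, not_not] at hcon
    refine hz (ContinuousLinearMap.coeFn_injective ?_)
    refine (TopologicalSpace.denseRange_denseSeq F).equalizer (m.toFun (f ⁻¹' {z})).continuous
      continuous_const ?_
    exact funext hcon
  refine measure_mono_null hsub (measure_iUnion_null fun n => ?_)
  set x := TopologicalSpace.denseSeq F n
  have hu : ∀ k : ℕ, ∃ u : SimpleFunc ℂ ℂ,
      ∀ z, ‖((𝐞 (-(G z * k)) : Circle) : ℂ) - u z‖ ≤ 1 / ((k : ℝ) + 1) := fun k => by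
    refine exists_simpleFunc_norm_sub_le ?_ (K := 1) (fun z => (Circle.norm_coe _).le)
      (by positivity)
    exact (continuous_subtype_val.comp Real.continuous_fourierChar).measurable.comp
      (hG.mul_const _).neg
  choose u hu using hu
  set V : ℕ → F →L[ℂ] F := fun k => m.simpleIntegral ((u k).comp f hf)
  have hV : ∀ k, m.HasIntegral (fun s => u k (f s)) (V k) :=
    fun k => m.hasIntegral_simpleFunc ((u k).comp f hf)
  have hu2 : ∀ k z, ‖u k z‖ ≤ 2 := fun k z => by
    have h1 := norm_sub_le ((𝐞 (-(G z * k)) : Circle) : ℂ)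
      (((𝐞 (-(G z * k)) : Circle) : ℂ) - u k z)
    rw [sub_sub_cancel, Circle.norm_coe] at h1
    have h2 : 1 / ((k : ℝ) + 1) ≤ 1 := by
      rw [div_le_one (by positivity)]; linarith [Nat.cast_nonneg (α := ℝ) k]
    linarith [hu k z]
  obtain ⟨w, φ, hφ, hw⟩ := hF (fun k => V k x) (by
    rw [(PolynormableSpace.withSeminorms ℂ F).isVonNBounded_iff_seminorm_bounded]
    rintro ⟨p, hp⟩
    obtain ⟨q, hq, hpq⟩ := hm p hp
    refine ⟨4 * 2 * q x + 1, by positivity, ?_⟩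
    rintro _ ⟨k, rfl⟩
    have := (hV k).seminorm_le hp hpq zero_le_two (fun s => hu2 k _) x
    exact this.trans_lt (lt_add_one _))
  refine measure_mono_null (fun z hz => ?_) (hGν φ hφ)
  have hI := m.hasIntegral_indicator (hf (measurableSet_singleton z))
  have hz : m.toFun (f ⁻¹' {z}) x ≠ 0 := hz
  obtain ⟨y, hy⟩ : ∃ y : F →L[ℂ] ℂ, y (m.toFun (f ⁻¹' {z}) x) ≠ 0 := by
    by_contra! hcon
    exact hz (eq_zero_of_forall_dual _ hcon)
  -- The projection for `{z}` turns `V k` into multiplication by the number `u k z`, so weak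
  -- convergence of `V (φ k) x` makes `u (φ k) z` converge.
  have h1 : ∀ k, m.toFun (f ⁻¹' {z}) (V k x) = u k z • m.toFun (f ⁻¹' {z}) x := fun k => by
    have : m.toFun (f ⁻¹' {z}) * V k = u k z • m.toFun (f ⁻¹' {z}) := by
      refine (hI.mul hm (hV k)).unique hm ((hI.smul _).congr fun s => ?_)
      by_cases hs : s ∈ f ⁻¹' {z}
      · rw [show f s = z from hs, mul_comm]
      · rw [Set.indicator_of_notMem hs, zero_mul, mul_zero]
    exact congrArg (fun T : F →L[ℂ] F => T x) this
  have h2 := (hw (y.comp (m.toFun (f ⁻¹' {z})))).mul_const (y (m.toFun (f ⁻¹' {z}) x))⁻¹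
  simp only [ContinuousLinearMap.comp_apply, h1, map_smul, smul_eq_mul,
    mul_inv_cancel_right₀ hy] at h2
  have h3 : Tendsto (fun k => ((𝐞 (-(G z * (φ k : ℕ))) : Circle) : ℂ) - u (φ k) z) atTop (𝓝 0) :=
    squeeze_zero_norm (fun k => hu (φ k) z)
      (tendsto_one_div_add_atTop_nhds_zero_nat.comp hφ.tendsto_atTop)
  have h4 := h3.add h2
  simp only [sub_add_cancel] at h4
  exact ⟨_, h4⟩

/-- If the part of the spectrum in `B` consists of eigenvalues, then a functional that annihilates
the eigencomponents of `ψ` to eigenvalues in `B` annihilates the spectral component of `B`. -/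
theorem dual_resolution_eq_zero [TopologicalSpace.SeparableSpace F]
    (hF : LocallySeqWeaklyCompact F) (hm : m.IsEquicontinuous) {f : S → ℂ} (hf : Measurable f)
    {U : F →L[ℂ] F} (hU : m.HasIntegral f U) {B : Set ℂ} (hB : MeasurableSet B)
    (hBσ : opSpectrum U ∩ B ⊆ opPointSpectrum U) (ψ : F) (y : F →L[ℂ] ℂ)
    (hy : ∀ μ ∈ opPointSpectrum U ∩ B, y (m.resolution f {μ} ψ) = 0) : y (m.resolution f B ψ) = 0 := by
  have hres : ∀ μ : ℂ, m.toFun (f ⁻¹' {μ}) ≠ 0 ↔ μ ∈ opPointSpectrum U :=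
    fun μ => toFun_preimage_singleton_ne_zero_iff hm hf hU μ
  by_contra hne
  set a := y (m.resolution f B ψ)
  -- This factor makes the value of the functional at `ψ'` equal to `|a|² > 0`.
  set y' : F →L[ℂ] ℂ := (starRingEnd ℂ a) • y
  set ψ' := m.resolution f B ψ
  have hy' : ∀ μ : ℂ, y' (m.toFun (f ⁻¹' {μ}) ψ') = 0 := fun μ => by
    rw [show ψ' = m.toFun (f ⁻¹' B) ψ from rfl,
      inter_apply m (hf (measurableSet_singleton μ)) (hf hB), ← Set.preimage_inter]
    by_cases hμ : μ ∈ B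
    · rw [Set.singleton_inter_of_mem hμ]
      by_cases hμσ : μ ∈ opPointSpectrum U
      · have := hy μ ⟨hμσ, hμ⟩
        simp only [y', smul_apply]
        rw [show y (m.toFun (f ⁻¹' {μ}) ψ) = 0 from this, smul_zero]
      · rw [← hres, not_not] at hμσ
        simp [hμσ]
    · rw [Set.singleton_inter_eq_empty.2 hμ]
      simp [toFun_empty]
  set κ : SignedMeasure ℂ := ComplexMeasure.re ((m.toComplexMeasure ψ' y').map f)
  have hκ : ∀ A, MeasurableSet A → κ A = (y' (m.toFun (f ⁻¹' A) ψ')).re := fun A hA => by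
    rw [← m.toComplexMeasure_apply ψ' y' (hf hA), ← VectorMeasure.map_apply _ hf hA]
    rfl
  -- If the positive part in the Hahn decomposition vanishes, the total mass is at most zero,
  -- contradicting `|a|² > 0`.
  obtain ⟨P, hP, hP0, hPc⟩ := κ.exists_compl_positive_negative
  set ν := κ.toMeasureOfZeroLE P hP hP0
  have hν : ∀ A, MeasurableSet A → ν.real A = (y' (m.toFun (f ⁻¹' (P ∩ A)) ψ')).re := fun A hA => by
    rw [← hκ _ (hP.inter hA)]
    exact κ.toMeasureOfZeroLE_real_apply hP0 hP hA
  have hνfin : IsFiniteMeasure ν := by infer_instance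
  have hνsing : NullSingletonClass ν := ⟨fun z => by
    rw [← measureReal_eq_zero_iff, hν _ (measurableSet_singleton z)]
    by_cases hz : z ∈ P
    · rw [Set.inter_singleton_of_mem hz, hy', Complex.zero_re]
    · rw [Set.inter_singleton_eq_empty.2 hz]
      simp [toFun_empty]⟩
  have hνB : ∀ᵐ z ∂ν, z ∈ B := by
    rw [ae_iff]
    change ν Bᶜ = 0
    rw [← measureReal_eq_zero_iff, hν _ hB.compl, show ψ' = m.toFun (f ⁻¹' B) ψ from rfl,
      inter_apply m (hf (hP.inter hB.compl)) (hf hB), ← Set.preimage_inter, Set.inter_assoc,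
      Set.compl_inter_self, Set.inter_empty]
    simp [toFun_empty]
  have hνσ : ∀ᵐ z ∂ν, z ∉ (opSpectrum U)ᶜ := by
    refine ae_notMem_of_measure_closedBall_le ν _ fun ξ hξ => ?_
    -- The exponent 3 beats the order `r²` of the area of a disc.
    obtain ⟨q, -, hq⟩ := exists_seminorm_toFun_closedBall_le hm hf hU hξ 3
      (y'.comp (m.toFun (f ⁻¹' P))).toSeminorm (y'.comp (m.toFun (f ⁻¹' P))).continuous.norm
    refine ⟨4 ^ 3 * q ψ', fun r hr => ?_⟩
    have h1 : ‖y' (m.toFun (f ⁻¹' P) (m.toFun (f ⁻¹' Metric.closedBall ξ r) ψ'))‖ ≤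
      (4 * r) ^ 3 * q ψ' := hq r hr.le ψ'
    rw [inter_apply m (hf hP) (hf measurableSet_closedBall), ← Set.preimage_inter] at h1
    rw [hν _ measurableSet_closedBall]
    refine ((Complex.re_le_norm _).trans h1).trans (le_of_eq (by ring))
  have hν0 : ν Set.univ = 0 := by
    have h1 := measure_setOf_toFun_preimage_singleton_ne_zero hF hm hf ν
    have h2 : ∀ᵐ z ∂ν, False := by
      have h3 : ∀ᵐ z ∂ν, ¬ m.toFun (f ⁻¹' {z}) ≠ 0 := by
        rw [ae_iff]; simpa using h1
      filter_upwards [h3, hνσ, hνB] with z hz hzσ hzB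
      exact hz ((hres z).2 (hBσ ⟨not_not.1 hzσ, hzB⟩))
    rw [ae_iff] at h2
    simpa using h2
  have h1 : κ Set.univ = κ P + κ Pᶜ := by
    rw [← κ.of_union disjoint_compl_right hP hP.compl, Set.union_compl_self]
  have h2 : κ Pᶜ ≤ 0 := by
    have := hPc Pᶜ hP.compl
    rwa [VectorMeasure.restrict_apply _ hP.compl hP.compl, Set.inter_self,
      VectorMeasure.restrict_zero] at this
  have h3 : κ P = 0 := by
    have := hν Set.univ MeasurableSet.univ
    rw [Set.inter_univ, ← hκ P hP, measureReal_def, hν0] at this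
    simpa using this.symm
  have h4 : κ Set.univ = ‖a‖ ^ 2 := by
    rw [hκ _ MeasurableSet.univ, Set.preimage_univ, m.univ_eq_one]
    simp only [y', smul_apply, one_apply_eq_self, smul_eq_mul]
    rw [show y ψ' = a from rfl, mul_comm, Complex.mul_conj, Complex.ofReal_re,
      Complex.normSq_eq_norm_sq]
  have h5 : 0 < ‖a‖ ^ 2 := by have := norm_pos_iff.2 hne; positivity
  linarith

end OperatorSpectralMeasure

/-! ### Atomic decomposition and convergence of the averages -/

namespace OperatorSpectralMeasure

open MeasureTheory

variable {F : Type*} [AddCommGroup F] [Module ℂ F] [TopologicalSpace F]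
  [IsTopologicalAddGroup F] [ContinuousSMul ℂ F] [PolynormableSpace ℂ F] [T2Space F]
  {S : Type*} [MeasurableSpace S] {m : OperatorSpectralMeasure S F}

theorem resolution_resolution (m : OperatorSpectralMeasure S F) {f : S → ℂ} (hf : Measurable f)
    {A B : Set ℂ} (hA : MeasurableSet A) (hB : MeasurableSet B) (x : F) :
    m.resolution f A (m.resolution f B x) = m.resolution f (A ∩ B) x :=
  m.inter_apply (hf hA) (hf hB) x

theorem resolution_empty (m : OperatorSpectralMeasure S F) (f : S → ℂ) :
    m.resolution f ∅ = 0 := m.toFun_empty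

theorem resolution_finset (m : OperatorSpectralMeasure S F) {f : S → ℂ} (hf : Measurable f)
    (t : Finset ℂ) : m.resolution f t = ∑ μ ∈ t, m.resolution f {μ} := by
  unfold resolution
  rw [← m.toFun_biUnion_finset t _ fun μ _ => hf (measurableSet_singleton μ)]
  · congr 1
    ext s; simp
  · intro μ _ μ' _ h
    exact Disjoint.preimage _ (by simpa using h)

theorem measurableSet_lt_norm (r : ℝ) : MeasurableSet {z : ℂ | r < ‖z‖} :=
  measurableSet_lt measurable_const measurable_norm

/-- Above the radius of dominating point spectrum the spectral measure is purely atomic. -/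
theorem hasSum_resolution_largerEigenvalues [TopologicalSpace.SeparableSpace F]
    (hF : LocallySeqWeaklyCompact F) (hm : m.IsEquicontinuous) {f : S → ℂ} (hf : Measurable f)
    {U : F →L[ℂ] F} (hU : m.HasIntegral f U) {R : ℝ} (hR : IsDominatingRadius U R) {lam : ℂ}
    (hlamR : R ≤ ‖lam‖) (ψ : F) :
    HasSum (fun ν : largerEigenvalues U lam => m.resolution f {(ν : ℂ)} ψ)
      (m.resolution f {z | ‖lam‖ < ‖z‖} ψ) := by
  classical
  set B : Set ℂ := {z | ‖lam‖ < ‖z‖}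
  have hB : MeasurableSet B := measurableSet_lt_norm _
  set N := Submodule.span ℂ (Set.range fun ν : largerEigenvalues U lam => m.resolution f {(ν : ℂ)} ψ)
  have hcl : m.resolution f B ψ ∈ closure (N : Set F) := by
    refine mem_closure_of_forall_dual N _ fun y hy => ?_
    refine dual_resolution_eq_zero hF hm hf hU hB (fun z hz => ?_) ψ y fun μ hμ => ?_
    -- The radius `‖z‖` exceeds `R`, and `z` is outside the open disc of this radius.
    · exact hR.eigenvalues ‖z‖ (hlamR.trans_lt hz.2) ⟨hz.1, by simp⟩
    · exact hy _ (Submodule.subset_span ⟨⟨μ, hμ.1, hμ.2⟩, rfl⟩)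
  rw [HasSum, SummationFilter.unconditional_filter, tendsto_iff_seminorm]
  intro p hp
  obtain ⟨q, hq, hpq⟩ := hm p hp
  rw [Metric.tendsto_nhds]
  intro ε hε
  obtain ⟨v, hv, hqv⟩ := exists_seminorm_sub_lt_of_mem_closure hcl hq hε
  obtain ⟨c, rfl⟩ := (Finsupp.mem_span_range_iff_exists_finsupp).1 hv
  -- Once `t` contains the support, the projection of `B \ t'` kills the approximating combination,
  -- and the error is this projection applied to a `q`-small vector.
  filter_upwards [eventually_ge_atTop c.support] with t ht
  rw [Real.dist_eq, sub_zero, abs_of_nonneg (apply_nonneg _ _)]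
  set t' : Finset ℂ := t.image Subtype.val
  have htB : (t' : Set ℂ) ⊆ B := by
    intro z hz
    obtain ⟨μ, -, rfl⟩ := Finset.mem_image.1 hz
    exact μ.2.2
  have hsum : ∑ μ ∈ t, m.resolution f {(μ : ℂ)} ψ = m.resolution f t' ψ := by
    rw [resolution_finset m hf, sum_apply, Finset.sum_image Subtype.val_injective.injOn]
  have hdiff : m.resolution f B ψ - m.resolution f t' ψ = m.resolution f (B \ t') ψ := by
    have := m.toFun_union (hf t'.measurableSet) (hf (hB.diff t'.measurableSet))
      (Disjoint.preimage f disjoint_sdiff_self_right)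
    rw [← Set.preimage_union, Set.union_sdiff_cancel htB] at this
    unfold resolution
    rw [this]; simp
  have hkill : m.resolution f (B \ t') (c.sum fun i a => a • m.resolution f {(i : ℂ)} ψ) = 0 := by
    rw [Finsupp.sum, map_sum]
    refine Finset.sum_eq_zero fun μ hμ => ?_
    rw [map_smul, resolution_resolution m hf (hB.diff t'.measurableSet) (measurableSet_singleton _),
      Set.inter_singleton_eq_empty.2, resolution_empty]
    · simp
    · exact fun h => h.2 (by simpa [t'] using ht hμ)
  have hB2 : m.resolution f (B \ t') (m.resolution f B ψ) = m.resolution f (B \ t') ψ := by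
    rw [resolution_resolution m hf (hB.diff t'.measurableSet) hB,
      Set.inter_eq_left.2 Set.sdiff_subset]
  rw [hsum, map_sub_rev, hdiff, ← hB2, ← sub_zero (m.resolution f (B \ t') _), ← hkill, ← map_sub]
  exact (hpq _ (hf (hB.diff t'.measurableSet)) _).trans_lt hqv

/-- The integral representation of `λ⁻¹ U` with the spectrum of modulus larger than `|λ|`
removed. -/
theorem hasIntegral_inv_smul_mul_one_sub (hm : m.IsEquicontinuous) {f : S → ℂ} (hf : Measurable f)
    {U : F →L[ℂ] F} (hU : m.HasIntegral f U) (lam : ℂ) :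
    m.HasIntegral ((f ⁻¹' {z | ‖lam‖ < ‖z‖}ᶜ).indicator fun s => lam⁻¹ * f s)
      (lam⁻¹ • (U * (1 - m.resolution f {z | ‖lam‖ < ‖z‖}))) := by
  have hB := measurableSet_lt_norm ‖lam‖
  have hI := m.hasIntegral_indicator (hf hB.compl)
  rw [Set.preimage_compl, m.toFun_compl (hf hB)] at hI
  refine ((hU.mul hm hI).smul lam⁻¹).congr fun s => ?_
  rw [Set.preimage_compl]
  by_cases hs : s ∈ (f ⁻¹' {z | ‖lam‖ < ‖z‖})ᶜ
  · rw [Set.indicator_of_mem hs, Set.indicator_of_mem hs, mul_one]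
  · rw [Set.indicator_of_notMem hs, Set.indicator_of_notMem hs, mul_zero, mul_zero]

/-- The truncated integrand has modulus at most one and equals `1` exactly where `f = lam`, so the
mean ergodic theorem applies. -/
theorem tendsto_opAverage_inv_smul_mul_one_sub (hm : m.IsEquicontinuous) {f : S → ℂ}
    (hf : Measurable f) {U : F →L[ℂ] F} (hU : m.HasIntegral f U) {lam : ℂ} (hlam : lam ≠ 0)
    (ψ : F) :
    Tendsto (fun n : ℕ =>
      opAverage n (lam⁻¹ • (U * (1 - m.resolution f {z | ‖lam‖ < ‖z‖}))) ψ) atTop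
      (𝓝 (m.resolution f {lam} ψ)) := by
  have hB := measurableSet_lt_norm ‖lam‖
  have hT := hasIntegral_inv_smul_mul_one_sub hm hf hU lam
  set g := (f ⁻¹' {z | ‖lam‖ < ‖z‖}ᶜ).indicator fun s => lam⁻¹ * f s
  have hg : Measurable g := (hf.const_mul _).indicator (hf hB.compl)
  have hg1 : ∀ s, ‖g s‖ ≤ 1 := fun s => by
    by_cases hs : s ∈ f ⁻¹' {z | ‖lam‖ < ‖z‖}ᶜ
    · rw [show g s = lam⁻¹ * f s from Set.indicator_of_mem hs _, norm_mul, norm_inv, inv_mul_le_one₀ (norm_pos_iff.2 hlam)]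
      exact not_lt.1 hs
    · rw [show g s = 0 from Set.indicator_of_notMem hs _]; simp
  have hset : g ⁻¹' {1} = f ⁻¹' {lam} := by
    ext s
    simp only [Set.mem_preimage, Set.mem_singleton_iff]
    by_cases hs : s ∈ f ⁻¹' {z | ‖lam‖ < ‖z‖}ᶜ
    · rw [show g s = lam⁻¹ * f s from Set.indicator_of_mem hs _, inv_mul_eq_one₀ hlam, eq_comm]
    · rw [show g s = 0 from Set.indicator_of_notMem hs _]
      refine ⟨fun h => absurd h zero_ne_one, fun h => absurd ?_ hs⟩
      simp [h]
  have := tendsto_opAverage hm hg hg1 hT ψ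
  rwa [hset] at this

/-- The complementary projection is idempotent and commutes with `U`. For `k = 0` it would be lost
from the left side. -/
theorem inv_smul_mul_one_sub_pow_apply (hm : m.IsEquicontinuous) {f : S → ℂ}
    (hf : Measurable f) {U : F →L[ℂ] F} (hU : m.HasIntegral f U) (lam : ℂ) {B : Set ℂ}
    (hB : MeasurableSet B) {k : ℕ} (hk : k ≠ 0) (ψ : F) :
    ((lam⁻¹ • (U * (1 - m.resolution f B))) ^ k) ψ =
      (lam⁻¹) ^ k • (U ^ k) ((1 - m.resolution f B) ψ) := by
  have hI := m.hasIntegral_indicator (hf hB.compl)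
  have hidem : IsIdempotentElem (m.toFun (f ⁻¹' Bᶜ)) := by
    rw [IsIdempotentElem, ← m.inter_eq_mul _ _ (hf hB.compl) (hf hB.compl), Set.inter_self]
  have hcomm := hU.commute hm hI
  rw [show 1 - m.resolution f B = m.toFun (f ⁻¹' Bᶜ) from (m.toFun_compl (hf hB)).symm,
    smul_pow, hcomm.mul_pow, hidem.pow_eq hk]
  rfl

/-- The averages of `λ⁻¹ U` converge on vectors from which finitely many eigencomponents,
including all those to eigenvalues of modulus larger than `|λ|`, have been removed. -/
theorem tendsto_opAverage_sub_sum [TopologicalSpace.SeparableSpace F]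
    (hF : LocallySeqWeaklyCompact F) (hm : m.IsEquicontinuous) {f : S → ℂ} (hf : Measurable f)
    {U : F →L[ℂ] F} (hU : m.HasIntegral f U) {R : ℝ} (hR : IsDominatingRadius U R) {lam : ℂ}
    (hlamR : R ≤ ‖lam‖) (t : Finset ℂ) (hlt : lam ∉ t) (ht : largerEigenvalues U lam ⊆ t) (ψ : F) :
    Tendsto (fun n : ℕ => opAverage n (lam⁻¹ • U) (ψ - ∑ μ ∈ t, m.resolution f {μ} ψ)) atTop
      (𝓝 (m.resolution f {lam} ψ)) := by
  have hlam0 : lam ≠ 0 := norm_pos_iff.1 (hR.pos.trans_le hlamR)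
  have hB := measurableSet_lt_norm ‖lam‖
  have htm := t.measurableSet
  have hρ : ψ - ∑ μ ∈ t, m.resolution f {μ} ψ = m.resolution f (t : Set ℂ)ᶜ ψ := by
    rw [← sum_apply, ← resolution_finset m hf]
    unfold resolution
    rw [Set.preimage_compl, m.toFun_compl (hf htm)]
    rfl
  -- This component is the sum of the larger eigencomponents, all removed together with `t`. Hence
  -- truncating `U` does not change its powers on the remaining vector.
  have hQρ : m.resolution f {z | ‖lam‖ < ‖z‖} (m.resolution f (t : Set ℂ)ᶜ ψ) = 0 := by
    rw [resolution_resolution m hf hB htm.compl, Set.inter_comm,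
      ← resolution_resolution m hf htm.compl hB]
    have h := (m.resolution f (t : Set ℂ)ᶜ).hasSum
      (hasSum_resolution_largerEigenvalues hF hm hf hU hR hlamR ψ)
    refine h.unique ?_
    convert! hasSum_zero with μ
    rw [resolution_resolution m hf htm.compl (measurableSet_singleton _),
      Set.inter_singleton_eq_empty.2 (not_not.2 (ht μ.2)), resolution_empty]
    rfl
  have hPρ : m.resolution f {lam} (m.resolution f (t : Set ℂ)ᶜ ψ) = m.resolution f {lam} ψ := by
    rw [resolution_resolution m hf (measurableSet_singleton _) htm.compl,
      Set.inter_eq_left.2 (by simpa using hlt)]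
  have h := tendsto_opAverage_inv_smul_mul_one_sub hm hf hU hlam0 (m.resolution f (t : Set ℂ)ᶜ ψ)
  rw [hPρ] at h
  rw [hρ]
  refine h.congr fun n => ?_
  simp only [opAverage, smul_apply, sum_apply]
  congr 1
  refine Finset.sum_congr rfl fun k _ => ?_
  rcases eq_or_ne k 0 with rfl | hk
  · simp
  · rw [inv_smul_mul_one_sub_pow_apply hm hf hU lam hB hk, smul_pow]
    simp [hQρ]

end OperatorSpectralMeasure

/-! ### The main theorem -/

theorem mainTheorem1 {F : Type*} [AddCommGroup F] [Module ℂ F] [TopologicalSpace F]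
    [IsTopologicalAddGroup F] [ContinuousSMul ℂ F] [PolynormableSpace ℂ F] [T2Space F]
    [TopologicalSpace.SeparableSpace F] (hF : LocallySeqWeaklyCompact F)
    {S : Type*} [MeasurableSpace S] (m : OperatorSpectralMeasure S F) (hm : m.IsEquicontinuous)
    (f : S → ℂ) (hf : Measurable f) (hfb : ∃ C : ℝ, ∀ s, ‖f s‖ ≤ C)
    (U : F →L[ℂ] F) (hU : m.HasIntegral f U)
    (R : ℝ) (hR : IsDominatingRadius U R) (hcirc : PointSpectrumOnIsolatedCircles f U)
    (lam : ℂ) (hlam : lam ∈ opPointSpectrum U) (hlamR : R ≤ ‖lam‖) :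
    -- `E({lam})` projects onto the eigenspace of `lam`
    Set.range (m.resolution f {lam}) = {ψ : F | U ψ = lam • ψ} ∧
    -- `Q` is the strongly convergent sum of the projections onto the larger eigenspaces
    (∃ Q : F →L[ℂ] F,
      (∀ ψ : F, HasSum (fun ν : largerEigenvalues U lam => m.resolution f {(ν : ℂ)} ψ) (Q ψ)) ∧
      (∀ ψ : F, Tendsto (fun n : ℕ => opAverage n (lam⁻¹ • (U * (1 - Q))) ψ) atTop
        (𝓝 (m.resolution f {lam} ψ))) ∧
      (∀ ψ : F, Tendsto
        (fun n : ℕ => (n : ℂ)⁻¹ • ∑ k ∈ Finset.Ico 1 n, (lam⁻¹) ^ k • (U ^ k) ((1 - Q) ψ)) atTop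
        (𝓝 (m.resolution f {lam} ψ)))) ∧
    -- the finite recursion, in any order of nonincreasing modulus
    (∀ (N : ℕ) (ν : Fin N → ℂ), Function.Injective ν → Set.range ν = largerEigenvalues U lam →
      Antitone (fun j => ‖ν j‖) → ∀ ψ : F, ∃ ρ : Fin (N + 1) → F, ρ 0 = ψ ∧
        (∀ j : Fin N,
          Tendsto (fun n : ℕ => opAverage n ((ν j)⁻¹ • U) (ρ j.castSucc)) atTop
            (𝓝 (m.resolution f {ν j} ψ)) ∧
          ρ j.succ = ρ j.castSucc - m.resolution f {ν j} ψ) ∧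
        Tendsto (fun n : ℕ => opAverage n (lam⁻¹ • U) (ρ (Fin.last N))) atTop
          (𝓝 (m.resolution f {lam} ψ))) := by
  have hlam0 : lam ≠ 0 := norm_pos_iff.1 (hR.pos.trans_le hlamR)
  refine ⟨OperatorSpectralMeasure.range_resolution_singleton hm hf hU lam,
    ⟨m.resolution f {z | ‖lam‖ < ‖z‖}, ?_, ?_, ?_⟩, ?_⟩
  · exact OperatorSpectralMeasure.hasSum_resolution_largerEigenvalues hF hm hf hU hR hlamR
  · exact OperatorSpectralMeasure.tendsto_opAverage_inv_smul_mul_one_sub hm hf hU hlam0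
  · intro ψ
    have h1 := OperatorSpectralMeasure.tendsto_opAverage_inv_smul_mul_one_sub hm hf hU hlam0 ψ
    -- The sum starting at `k = 1` differs from the average only by `ψ / n`.
    have h2 : Tendsto (fun n : ℕ => (n : ℂ)⁻¹ • ψ) atTop (𝓝 0) := by
      simpa using (tendsto_inv_atTop_nhds_zero_nat (𝕜 := ℂ)).smul_const ψ
    have h3 := h1.sub h2
    rw [sub_zero] at h3
    refine h3.congr' ?_
    filter_upwards [eventually_gt_atTop 0] with n hn
    rw [opAverage, smul_apply, sum_apply, ← smul_sub, Finset.sum_range_eq_add_Ico _ hn, pow_zero,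
      one_apply_eq_self, add_sub_cancel_left]
    congr 1
    refine Finset.sum_congr rfl fun k hk => ?_
    exact OperatorSpectralMeasure.inv_smul_mul_one_sub_pow_apply hm hf hU lam
      (OperatorSpectralMeasure.measurableSet_lt_norm _)
      (Nat.one_le_iff_ne_zero.1 (Finset.mem_Ico.1 hk).1) ψ
  · intro N ν hν hrange hanti ψ
    classical
    have hmem : ∀ i, ν i ∈ largerEigenvalues U lam := fun i => hrange ▸ Set.mem_range_self i
    refine ⟨fun j : Fin (N + 1) => ψ - ∑ i ∈ Finset.univ.filter fun i : Fin N => (i : ℕ) < j, m.resolution f {ν i} ψ, by simp,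
      fun j => ⟨?_, ?_⟩, ?_⟩
    · have h := OperatorSpectralMeasure.tendsto_opAverage_sub_sum hF hm hf hU hR (lam := ν j)
        (hlamR.trans (hmem j).2.le) (Finset.image ν (Finset.univ.filter fun i : Fin N => (i : ℕ) < j))
        (fun hj => by
          obtain ⟨i, hi, hij⟩ := Finset.mem_image.1 hj
          rw [hν hij] at hi
          simp at hi)
        -- An eigenvalue of modulus larger than `‖ν j‖` is among the `ν i`, and by monotonicity its
        -- index is below `j`.
        (fun z hz => by
          obtain ⟨i, rfl⟩ : z ∈ Set.range ν := hrange ▸ ⟨hz.1, (hmem j).2.trans hz.2⟩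
          refine Finset.mem_coe.2 (Finset.mem_image_of_mem _ ?_)
          simp only [Finset.mem_filter, Finset.mem_univ, true_and]
          by_contra hij
          exact absurd (hanti (not_lt.1 hij : j ≤ i)) (not_le.2 hz.2)) ψ
      rw [Finset.sum_image hν.injOn] at h
      exact h
    · have hins : (Finset.univ.filter fun i : Fin N => (i : ℕ) < j.succ) =
          insert j (Finset.univ.filter fun i : Fin N => (i : ℕ) < j.castSucc) := by
        ext i
        simp [Fin.ext_iff, le_iff_eq_or_lt]
      beta_reduce
      rw [hins, Finset.sum_insert (by simp)]
      abel
    · have h := OperatorSpectralMeasure.tendsto_opAverage_sub_sum hF hm hf hU hR hlamR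
        (Finset.image ν (Finset.univ.filter fun i : Fin N => (i : ℕ) < Fin.last N))
        (fun hj => by
          obtain ⟨i, -, hi⟩ := Finset.mem_image.1 hj
          exact lt_irrefl _ (hi ▸ (hmem i).2))
        (fun z hz => by
          obtain ⟨i, rfl⟩ : z ∈ Set.range ν := hrange ▸ hz
          exact Finset.mem_coe.2 (Finset.mem_image_of_mem _ (by simp))) ψ
      rw [Finset.sum_image hν.injOn] at h
      exact h
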